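/- A sampler on $\{0,1\}^d$ with dataset size $n$ is a randomized map $A:(\{0,1\}^d)^n\to\{0,1\}^d$. Two datasets are neighbors if they differ in at most one record. $A$ is $(\varepsilon,\delta)$-DP if $\Pr[A(x)\in Y]\le e^{\varepsilon}\Pr[A(x')\in Y]+\delta$ for all neighbors $x,x'$ and all $Y\subseteq\{0,1\}^d$. $A$ is $\rho$-zCDP if $\frac1{a-1}\log\sum_{z}\Pr[A(x)=z]^{a}\Pr[A(x')=z]^{1-a}\le\rho a$ for all neighbors $x,x'$ and all $a>1$. Let $\mathcal B^{\otimes d}$ be the class of all products of $d$ Bernoulli distributions, with arbitrary biases in $[0,1]$. $A$ is $\alpha$-accurate on $\mathcal B^{\otimes d}$ if for every $P\in\mathcal B^{\otimes d}$ the law of $A(X_1,\dots,X_n)$, with $X_1,\dots,X_n$ independent with law $P$ (and independent of the coins of $A$), is within total variation distance $\alpha$ of $P$. (1) For all $a\in\mathbb R$ and $k\in\mathbb N$ there are $C>0$ and $K\in\mathbb N$, depending only on $a$ and $k$, such that for all $d,n\in\mathbb N$ and all $\varepsilon,\delta,\alpha\in(0,1)$ with $\log(1/\delta)\le a(\log n)^k$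 and $$n\ \ge\ C\,\frac{d}{\alpha\varepsilon}\,\log^{K}\!\Big(e+\frac{d}{\alpha\varepsilon}\Big)$$ there is an $(\varepsilon,\delta)$-DP sampler with dataset size $n$ that is $\alpha$-accurate on $\mathcal B^{\otimes d}$; if $\delta\le\frac12$, the same sampler can be taken to be also $\rho$-zCDP with $\rho=\frac{\varepsilon^2}{16\log(1/\delta)}$. In short: if $\log(1/\delta)=\mathrm{polylog}(n)$, datasets of size $n=\tilde O\big(\frac d{\alpha\varepsilon}\big)$ suffice. (2) There are constants $C>0$ and $d_0\in\mathbb N$ such that for all $d\ge d_0$, $\rho\in(0,1]$, $\alpha\in(0,1)$ and all $n\in\mathbb N$ with $$n\ \ge\ C\,\frac{d}{\alpha\sqrt{\rho}}\Big(\log^{9/4}d+\log^{5/4}\frac1{\alpha\sqrt\rho}\Big)$$ there is a $\rho$-zCDP sampler with dataset size $n$ that is $\alpha$-accurate on $\mathcal B^{\otimes d}$. -/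

import Mathlib

open scoped ENNReal

noncomputable section

namespace DPSampling

/-- A randomized algorithm that maps a dataset of `n` records from `U` to one random element of `U`.
The randomness ("coins") of the algorithm is recorded by its output distribution on each dataset. -/
abbrev Sampler (U : Type*) (n : ℕ) := (Fin n → U) → PMF U

/-- Two datasets are neighbors if they differ in at most one entry. -/
def Neighbors {U : Type*} [DecidableEq U] {n : ℕ} (x x' : Fin n → U) : Prop :=
  hammingDist x x' ≤ 1

/-- `(ε, δ)`-differential privacy. -/
def IsDP {U : Type*} [DecidableEq U] {n : ℕ} (ε δ : ℝ) (A : Sampler U n) : Prop :=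
  ∀ x x' : Fin n → U, Neighbors x x' → ∀ Y : Set U,
    (A x).toOuterMeasure Y ≤
      ENNReal.ofReal (Real.exp ε) * (A x').toOuterMeasure Y + ENNReal.ofReal δ

/-- The Rényi divergence of order `a > 1` of two distributions on a finite set,
`(a - 1)⁻¹ * log (∑ x, P x ^ a * Q x ^ (1 - a))`. It takes the value `⊤` if `P x ≠ 0` and `Q x = 0`
for some `x`; terms with `P x = 0` are `0`. -/
def renyiDiv {U : Type*} [Fintype U] (a : ℝ) (P Q : PMF U) : EReal :=
  (((a - 1)⁻¹ : ℝ) : EReal) * ENNReal.log (∑ x, P x ^ a * Q x ^ (1 - a))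

/-- `ρ`-zero-mean concentrated differential privacy. -/
def IsZCDP {U : Type*} [Fintype U] [DecidableEq U] {n : ℕ} (ρ : ℝ) (A : Sampler U n) : Prop :=
  ∀ x x' : Fin n → U, Neighbors x x' → ∀ a : ℝ, 1 < a →
    renyiDiv a (A x) (A x') ≤ ((ρ * a : ℝ) : EReal)

/-- The product of finitely many distributions on a finite set: the joint distribution of
independent random variables with laws `P i`. -/
def productPMF {ι β : Type*} [Fintype ι] [Fintype β] (P : ι → PMF β) : PMF (ι → β) :=
  letI := Classical.decEq ι
  PMF.ofFintype (fun x => ∏ i, P i (x i)) (by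
    rw [← Fintype.prod_sum fun i b => P i b]
    refine Finset.prod_eq_one fun i _ => ?_
    rw [← tsum_fintype (L := .unconditional _)]
    exact (P i).tsum_coe)

/-- The Bernoulli distribution with bias `p`. -/
def bernoulliPMF (p : unitInterval) : PMF Bool :=
  PMF.ofFintype (fun b => if b then ENNReal.ofReal p else ENNReal.ofReal (1 - p)) (by
    rw [Fintype.sum_bool]
    simp only [if_true, Bool.false_eq_true, if_false]
    rw [← ENNReal.ofReal_add p.2.1 (sub_nonneg.2 p.2.2)]
    simp)

/-- The class of products of `d` Bernoulli distributions, with arbitrary biases in `[0, 1]`. -/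
def bernoulliProducts (d : ℕ) : Set (PMF (Fin d → Bool)) :=
  Set.range fun p : Fin d → unitInterval => productPMF fun j => bernoulliPMF (p j)

/-- The law of the output of `A` on a dataset of `n` independent records with law `P`, over both
the data and the coins of `A`. -/
def outputDist {U : Type*} [Fintype U] {n : ℕ} (A : Sampler U n) (P : PMF U) : PMF U :=
  (productPMF fun _ : Fin n => P).bind A

/-- Total variation distance of distributions on a finite set. -/
def tvDist {U : Type*} [Fintype U] (P Q : PMF U) : ℝ :=
  (1 / 2) * ∑ x, |(P x).toReal - (Q x).toReal|

/-- `A` is `α`-accurate on the class `𝒞`. -/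
def IsAccurate {U : Type*} [Fintype U] {n : ℕ} (α : ℝ) (A : Sampler U n) (𝒞 : Set (PMF U)) :
    Prop :=
  ∀ P ∈ 𝒞, tvDist (outputDist A P) P ≤ α

end DPSampling

end

namespace DPSampling

/-! Both parts follow from one purely private sampler. Given m records, draw each output bit
independently from the empirical frequencies of its column, mixed with a little uniform noise τ ≈
α/d. Frequencies are unbiased and the columns of product data are independent, so the output law is
exactly a product with biases moved only by the noise: the error is O(dτ) (`le_sum_columnSampler`).

Changing a record costs privacy in column j in proportion to 1/(m q), where q is the frequency of
the old bit. Rare bits are costly but seldom seen: the average of 1/q over a column is O(1). Hence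
the weight of a record, τ times the sum over columns of 1/q, has mean O(dτ) = O(α), and a Chernoff
bound puts all weights below a threshold s except with probability O(α)
(`sum_exists_recordWeight_gt_le`). On such datasets the log-probabilities are Lipschitz in Hamming
distance (`columnSampler_le_exp_mul`), and a Lipschitz extension yields a sampler private on all
datasets (`exists_isPureDP_extension`).

This gives privacy 1 with m ≈ (d/α) · polylog records (`exists_isPureDP_one`). Drawing each of the m
records at random from its own group of about 1/η records lowers the privacy parameter to η without
changing the output law on i.i.d. data (`exists_isPureDP_subsample`). Pure η-privacy implies
(ε,δ)-privacy for η ≤ ε and, with full support, 4η²-zCDP. -/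

/-! ### Finite distributions and total variation. -/

/-- The distribution on a finite set with a given real probability mass function. -/
noncomputable def pmfOfReal {U : Type*} [Fintype U] (f : U → ℝ) (h0 : ∀ u, 0 ≤ f u)
    (h1 : ∑ u, f u = 1) : PMF U :=
  PMF.ofFintype (fun u => ENNReal.ofReal (f u)) (by
    rw [← ENNReal.ofReal_sum_of_nonneg fun u _ => h0 u, h1, ENNReal.ofReal_one])

theorem pmfOfReal_toReal {U : Type*} [Fintype U] (f : U → ℝ) (h0 : ∀ u, 0 ≤ f u)
    (h1 : ∑ u, f u = 1) (u : U) : (pmfOfReal f h0 h1 u).toReal = f u := by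
  simp [pmfOfReal, ENNReal.toReal_ofReal (h0 u)]

theorem sum_toReal_eq_one {U : Type*} [Fintype U] (P : PMF U) : ∑ u, (P u).toReal = 1 := by
  rw [← ENNReal.toReal_sum fun u _ => P.apply_ne_top u, ← tsum_fintype (L := .unconditional _),
    P.tsum_coe, ENNReal.toReal_one]

theorem toReal_productPMF {ι β : Type*} [Fintype ι] [Fintype β] (P : ι → PMF β) (x : ι → β) :
    (productPMF P x).toReal = ∏ i, (P i (x i)).toReal := by
  simp [productPMF, ENNReal.toReal_prod]

theorem toReal_outputDist {U : Type*} [Fintype U] {n : ℕ} (A : Sampler U n) (P : PMF U) (y : U) :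
    (outputDist A P y).toReal = ∑ x : Fin n → U, (∏ i, (P (x i)).toReal) * (A x y).toReal := by
  classical
  rw [outputDist, PMF.bind_apply, tsum_fintype, ENNReal.toReal_sum]
  · simp [toReal_productPMF]
  · intro x _
    exact ENNReal.mul_ne_top (PMF.apply_ne_top _ _) (PMF.apply_ne_top _ _)

/-- A one-sided pointwise bound on the difference of two distributions bounds their distance. -/
theorem tvDist_le {U : Type*} [Fintype U] {P Q : PMF U} {g : U → ℝ} {α : ℝ}
    (h : ∀ u, (P u).toReal - (Q u).toReal ≤ g u) (h0 : ∀ u, 0 ≤ g u) (hg : ∑ u, g u ≤ α) :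
    tvDist Q P ≤ α := by
  have key : ∑ u, |(Q u).toReal - (P u).toReal| ≤
      ∑ u, (2 * g u + ((Q u).toReal - (P u).toReal)) := by
    refine Finset.sum_le_sum fun u _ => abs_le.2 ⟨?_, ?_⟩ <;> linarith [h u, h0 u]
  rw [Finset.sum_add_distrib, Finset.sum_sub_distrib, sum_toReal_eq_one, sum_toReal_eq_one,
    ← Finset.mul_sum] at key
  unfold tvDist
  linarith

/-! ### Pure privacy and its consequences for approximate and concentrated privacy. -/

/-- Pure differential privacy, in terms of real probabilities. -/
def IsPureDP {U : Type*} [DecidableEq U] {n : ℕ} (η : ℝ) (A : Sampler U n) : Prop :=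
  ∀ x x' : Fin n → U, Neighbors x x' → ∀ y, (A x y).toReal ≤ Real.exp η * (A x' y).toReal

theorem Neighbors.symm {U : Type*} [DecidableEq U] {n : ℕ} {x x' : Fin n → U}
    (h : Neighbors x x') : Neighbors x' x := by
  unfold Neighbors at *
  rwa [hammingDist_comm]

theorem IsPureDP.mono {U : Type*} [DecidableEq U] {n : ℕ} {η η' : ℝ} {A : Sampler U n}
    (h : IsPureDP η A) (hη : η ≤ η') : IsPureDP η' A := fun x x' hx y =>
  (h x x' hx y).trans (mul_le_mul_of_nonneg_right (Real.exp_le_exp.2 hη) ENNReal.toReal_nonneg)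

theorem IsPureDP.isDP {U : Type*} [Fintype U] [DecidableEq U] {n : ℕ} {η ε δ : ℝ} {A : Sampler U n}
    (h : IsPureDP η A) (hη : η ≤ ε) : IsDP ε δ A := by
  classical
  intro x x' hx Y
  refine le_trans ?_ le_self_add
  rw [PMF.toOuterMeasure_apply_fintype, PMF.toOuterMeasure_apply_fintype, Finset.mul_sum]
  refine Finset.sum_le_sum fun y _ => ?_
  by_cases hy : y ∈ Y
  · simp only [Set.indicator_of_mem hy]
    rw [← ENNReal.ofReal_toReal ((A x).apply_ne_top y),
      ← ENNReal.ofReal_toReal ((A x').apply_ne_top y), ← ENNReal.ofReal_mul (Real.exp_pos _).le]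
    exact ENNReal.ofReal_le_ofReal (h.mono hη x x' hx y)
  · simp [Set.indicator_of_notMem hy]

/-- Splits off the linear term of a moment generating function: for a log-likelihood ratio its
expectation is a KL divergence, and what remains is of second order. -/
theorem exp_le_add_exp_sq (v : ℝ) : Real.exp v ≤ v + Real.exp (v ^ 2) := by
  have h2 := Real.add_one_le_exp (v ^ 2)
  rcases le_or_gt |v| 1 with hv | hv
  · have h1 := (abs_le.1 (Real.abs_exp_sub_one_sub_id_le hv)).2
    linarith
  · rcases lt_abs.1 hv with hv | hv
    · have : Real.exp v ≤ Real.exp (v ^ 2) := Real.exp_le_exp.2 (by nlinarith)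
      linarith
    · have : Real.exp v ≤ 1 := Real.exp_le_one_iff.2 (by linarith)
      nlinarith

/-- Distributions with bounded likelihood ratios have Rényi moments of sub-Gaussian type. -/
theorem sum_rpow_mul_rpow_le {U : Type*} [Fintype U] {p q : U → ℝ} {η a : ℝ}
    (hη0 : 0 ≤ η) (hη1 : η ≤ 1) (ha : 1 < a) (hq : ∀ u, 0 < q u) (hp : ∀ u, 0 < p u)
    (hp1 : ∑ u, p u = 1) (hq1 : ∑ u, q u = 1) (hpq : ∀ u, p u ≤ Real.exp η * q u)
    (hqp : ∀ u, q u ≤ Real.exp η * p u) :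
    ∑ u, p u ^ a * q u ^ (1 - a) ≤ Real.exp ((a - 1) * (4 * η ^ 2 * a)) := by
  have hexp : Real.exp η - 1 ≤ 2 * η := by
    have := (abs_le.1 (Real.abs_exp_sub_one_sub_id_le (x := η) (by rwa [abs_of_nonneg hη0]))).2
    nlinarith
  have hlog1 : ∀ u, Real.log (p u / q u) ≤ η := fun u => by
    rw [Real.log_le_iff_le_exp (div_pos (hp u) (hq u)), div_le_iff₀ (hq u)]
    exact hpq u
  have hlog2 : ∀ u, -η ≤ Real.log (p u / q u) := fun u => by
    rw [Real.le_log_iff_exp_le (div_pos (hp u) (hq u)), le_div_iff₀ (hq u), Real.exp_neg,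
      inv_mul_le_iff₀ (Real.exp_pos _)]
    exact hqp u
  have hsq : ∀ u, (p u - q u) ^ 2 / q u ≤ q u * (2 * η) ^ 2 := fun u => by
    rw [div_le_iff₀ (hq u)]
    have hA : p u - q u ≤ 2 * η * q u := by nlinarith [hpq u, hq u]
    have hB : -(2 * η * q u) ≤ p u - q u := by
      have : (2 - Real.exp η) * q u ≤ p u := by
        have h1 : q u * Real.exp (-η) ≤ p u := by
          rw [Real.exp_neg, ← div_eq_mul_inv, div_le_iff₀ (Real.exp_pos _), mul_comm]
          exact hqp u
        have h2 : 2 - Real.exp η ≤ Real.exp (-η) := by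
          have := Real.one_le_cosh η
          rw [Real.cosh_eq] at this
          linarith
        nlinarith [hq u]
      nlinarith [hq u]
    nlinarith [abs_le_abs hA (by linarith : -(p u - q u) ≤ 2 * η * q u), sq_le_sq' hB hA]
  -- KL is at most the χ² divergence, by log t ≤ t - 1; the extra terms `p u - q u` sum to zero.
  have hkl : ∑ u, p u * Real.log (p u / q u) ≤ 4 * η ^ 2 := by
    calc ∑ u, p u * Real.log (p u / q u)
        ≤ ∑ u, ((p u - q u) ^ 2 / q u + (p u - q u)) := by
          refine Finset.sum_le_sum fun u _ => ?_
          have h1 := Real.log_le_sub_one_of_pos (div_pos (hp u) (hq u))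
          have h2 : p u * (p u / q u - 1) = (p u - q u) ^ 2 / q u + (p u - q u) := by
            have := (hq u).ne'
            field_simp
            ring
          rw [← h2]
          exact mul_le_mul_of_nonneg_left h1 (hp u).le
      _ ≤ ∑ u, (q u * (2 * η) ^ 2 + (p u - q u)) :=
          Finset.sum_le_sum fun u _ => by linarith [hsq u]
      _ = 4 * η ^ 2 := by
          rw [Finset.sum_add_distrib, Finset.sum_sub_distrib, ← Finset.sum_mul, hp1, hq1]
          ring
  have hb : 0 < a - 1 := by linarith
  calc ∑ u, p u ^ a * q u ^ (1 - a)
      = ∑ u, p u * Real.exp ((a - 1) * Real.log (p u / q u)) := by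
        refine Finset.sum_congr rfl fun u _ => ?_
        rw [Real.log_div (hp u).ne' (hq u).ne', Real.rpow_def_of_pos (hp u),
          Real.rpow_def_of_pos (hq u)]
        nth_rewrite 2 [← Real.exp_log (hp u)]
        rw [← Real.exp_add, ← Real.exp_add]
        congr 1
        ring
    _ ≤ ∑ u, ((a - 1) * (p u * Real.log (p u / q u)) +
          p u * Real.exp ((a - 1) ^ 2 * η ^ 2)) := by
        refine Finset.sum_le_sum fun u _ => ?_
        have h1 := exp_le_add_exp_sq ((a - 1) * Real.log (p u / q u))
        have h2 : Real.exp (((a - 1) * Real.log (p u / q u)) ^ 2) ≤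
            Real.exp ((a - 1) ^ 2 * η ^ 2) := by
          rw [Real.exp_le_exp, mul_pow]
          exact mul_le_mul_of_nonneg_left (sq_le_sq' (hlog2 u) (hlog1 u)) (sq_nonneg _)
        nlinarith [mul_le_mul_of_nonneg_left (h1.trans (add_le_add_right h2 _)) (hp u).le]
    _ = (a - 1) * ∑ u, p u * Real.log (p u / q u) + Real.exp ((a - 1) ^ 2 * η ^ 2) := by
        rw [Finset.sum_add_distrib, ← Finset.mul_sum, ← Finset.sum_mul, hp1, one_mul]
    _ ≤ (a - 1) * (4 * η ^ 2) + Real.exp ((a - 1) ^ 2 * η ^ 2) := by gcongr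
    _ ≤ Real.exp ((a - 1) * (4 * η ^ 2)) * Real.exp ((a - 1) ^ 2 * η ^ 2) := by
        have h1 := Real.add_one_le_exp ((a - 1) * (4 * η ^ 2))
        have h2 : 1 ≤ Real.exp ((a - 1) ^ 2 * η ^ 2) := Real.one_le_exp (by positivity)
        have h3 : 0 ≤ (a - 1) * (4 * η ^ 2) := by positivity
        nlinarith
    _ ≤ Real.exp ((a - 1) * (4 * η ^ 2 * a)) := by
        rw [← Real.exp_add, Real.exp_le_exp]
        nlinarith [mul_nonneg (mul_nonneg hb.le hb.le) (sq_nonneg η)]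

theorem renyiDiv_le {U : Type*} [Fintype U] {P Q : PMF U} {η a : ℝ}
    (hη0 : 0 ≤ η) (hη1 : η ≤ 1) (ha : 1 < a)
    (hPQ : ∀ u, (P u).toReal ≤ Real.exp η * (Q u).toReal)
    (hQP : ∀ u, (Q u).toReal ≤ Real.exp η * (P u).toReal) (hP : ∀ u, P u ≠ 0) :
    renyiDiv a P Q ≤ ((4 * η ^ 2 * a : ℝ) : EReal) := by
  have hp : ∀ u, 0 < (P u).toReal := fun u => ENNReal.toReal_pos (hP u) (P.apply_ne_top u)
  have hq : ∀ u, 0 < (Q u).toReal := fun u => by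
    by_contra h
    have := hPQ u
    nlinarith [hp u, Real.exp_pos η]
  have hsum : ∑ u, P u ^ a * Q u ^ (1 - a) =
      ENNReal.ofReal (∑ u, (P u).toReal ^ a * (Q u).toReal ^ (1 - a)) := by
    rw [ENNReal.ofReal_sum_of_nonneg fun u _ => by positivity]
    refine Finset.sum_congr rfl fun u _ => ?_
    rw [ENNReal.ofReal_mul (by positivity), ← ENNReal.ofReal_rpow_of_pos (hp u),
      ← ENNReal.ofReal_rpow_of_pos (hq u), ENNReal.ofReal_toReal (P.apply_ne_top u),
      ENNReal.ofReal_toReal (Q.apply_ne_top u)]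
  have hle := sum_rpow_mul_rpow_le hη0 hη1 ha hq hp (sum_toReal_eq_one P) (sum_toReal_eq_one Q)
    hPQ hQP
  have hne : (Finset.univ : Finset U).Nonempty := by
    obtain ⟨u, -⟩ := P.support_nonempty
    exact ⟨u, Finset.mem_univ u⟩
  have hpos : 0 < ∑ u, (P u).toReal ^ a * (Q u).toReal ^ (1 - a) :=
    Finset.sum_pos (fun u _ => mul_pos (Real.rpow_pos_of_pos (hp u) _)
      (Real.rpow_pos_of_pos (hq u) _)) hne
  unfold renyiDiv
  rw [hsum, ENNReal.log_ofReal_of_pos hpos, ← EReal.coe_mul, EReal.coe_le_coe_iff]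
  rw [inv_mul_le_iff₀ (by linarith), Real.log_le_iff_le_exp hpos]
  exact hle

/-- A purely private sampler with full support is zero-concentrated private. -/
theorem IsPureDP.isZCDP {U : Type*} [Fintype U] [DecidableEq U] {n : ℕ} {η ρ : ℝ} {A : Sampler U n}
    (h : IsPureDP η A) (hA : ∀ x y, A x y ≠ 0) (hη0 : 0 ≤ η) (hη1 : η ≤ 1) (hρ : 4 * η ^ 2 ≤ ρ) :
    IsZCDP ρ A := fun x x' hx a ha =>
  (renyiDiv_le hη0 hη1 ha (h x x' hx) (h x' x hx.symm) (hA x)).trans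
    (EReal.coe_le_coe_iff.2 (mul_le_mul_of_nonneg_right hρ (by linarith)))

/-! ### Lipschitz extension. -/

/-- Extension of a private algorithm from a set `H` of datasets to all datasets. -/
theorem exists_isPureDP_extension {U : Type*} [Fintype U] [DecidableEq U] {n : ℕ} {ε : ℝ}
    (hε : 0 ≤ ε) (R : (Fin n → U) → U → ℝ) (hR : ∀ x y, 0 < R x y) (hR1 : ∀ x, ∑ y, R x y = 1)
    (H : Finset (Fin n → U)) (hH : H.Nonempty)
    (hRH : ∀ x ∈ H, ∀ x' ∈ H, ∀ y, R x y ≤ Real.exp (ε * hammingDist x x') * R x' y) :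
    ∃ A : Sampler U n, IsPureDP (2 * ε) A ∧ (∀ x y, A x y ≠ 0) ∧
      ∀ x ∈ H, ∀ y, (A x y).toReal = R x y := by
  -- McShane extension of log R, which keeps the Lipschitz constant ε. Normalizing `f` costs a
  -- second factor exp ε, hence `2 * ε`; on `H` it changes nothing, since there `f` equals `R` and
  -- already sums to 1.
  set f : (Fin n → U) → U → ℝ := fun x y =>
    H.sup' hH fun z => R z y * Real.exp (-(ε * hammingDist x z)) with hf
  have hfpos : ∀ x y, 0 < f x y := fun x y => by
    obtain ⟨z, hz⟩ := hH
    exact (Finset.lt_sup'_iff _).2 ⟨z, hz, mul_pos (hR z y) (Real.exp_pos _)⟩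
  have hflip : ∀ x x' y, Neighbors x x' → f x y ≤ Real.exp ε * f x' y := fun x x' y hx => by
    refine Finset.sup'_le _ _ fun z hz => ?_
    have h1 : R z y * Real.exp (-(ε * hammingDist x' z)) ≤ f x' y :=
      Finset.le_sup' (fun z => R z y * Real.exp (-(ε * hammingDist x' z))) hz
    refine le_trans ?_ (mul_le_mul_of_nonneg_left h1 (Real.exp_pos ε).le)
    rw [mul_left_comm, ← Real.exp_add]
    refine mul_le_mul_of_nonneg_left (Real.exp_le_exp.2 ?_) (hR z y).le
    have h2 : hammingDist x' z ≤ 1 + hammingDist x z :=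
      (hammingDist_triangle x' x z).trans (Nat.add_le_add_right hx.symm _)
    have h3 : (hammingDist x' z : ℝ) ≤ 1 + hammingDist x z := by exact_mod_cast h2
    nlinarith
  have hfH : ∀ x ∈ H, ∀ y, f x y = R x y := fun x hx y => by
    refine le_antisymm (Finset.sup'_le _ _ fun z hz => ?_) ?_
    · rw [Real.exp_neg, ← div_eq_mul_inv, div_le_iff₀ (Real.exp_pos _), mul_comm,
        hammingDist_comm]
      exact hRH z hz x hx y
    · have := Finset.le_sup' (fun z => R z y * Real.exp (-(ε * hammingDist x z))) hx
      simpa using this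
  have hU : Nonempty U := by
    by_contra hU
    rw [not_nonempty_iff] at hU
    obtain ⟨z, -⟩ := hH
    simpa using hR1 z
  have hZ : ∀ x, 0 < ∑ y, f x y := fun x =>
    Finset.sum_pos (fun y _ => hfpos x y) Finset.univ_nonempty
  let A : Sampler U n := fun x => pmfOfReal (fun y => f x y / ∑ y, f x y)
    (fun y => (div_pos (hfpos x y) (hZ x)).le) (by
      rw [← Finset.sum_div, div_self (hZ x).ne'])
  have hA : ∀ x y, (A x y).toReal = f x y / ∑ y, f x y := fun x y => pmfOfReal_toReal _ _ _ y
  refine ⟨A, fun x x' hx y => ?_, fun x y h0 => ?_, fun x hx y => ?_⟩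
  · rw [hA, hA, div_le_iff₀ (hZ x)]
    have h1 := hflip x x' y hx
    have h2 : ∑ y, f x' y ≤ Real.exp ε * ∑ y, f x y := by
      rw [Finset.mul_sum]
      exact Finset.sum_le_sum fun y _ => hflip x' x y hx.symm
    have h3 : f x' y ≤ Real.exp ε * (∑ y, f x y) * (f x' y / ∑ y, f x' y) := by
      calc f x' y = (∑ y, f x' y) * (f x' y / ∑ y, f x' y) := by
            rw [mul_div_cancel₀ _ (hZ x').ne']
        _ ≤ _ := mul_le_mul_of_nonneg_right h2 (div_pos (hfpos x' y) (hZ x')).le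
    calc f x y ≤ Real.exp ε * f x' y := h1
      _ ≤ Real.exp ε * (Real.exp ε * (∑ y, f x y) * (f x' y / ∑ y, f x' y)) :=
        mul_le_mul_of_nonneg_left h3 (Real.exp_pos _).le
      _ = _ := by rw [two_mul, Real.exp_add]; ring
  · have := hA x y
    rw [h0, ENNReal.toReal_zero] at this
    exact (div_pos (hfpos x y) (hZ x)).ne this
  · rw [hA, hfH x hx, Finset.sum_congr rfl fun y _ => hfH x hx y, hR1, div_one]

/-! ### Amplification by subsampling. -/

/-- Marginals of product distributions. -/
theorem sum_prod_mul_comp {ι κ U : Type*} [Fintype ι] [Fintype κ] [DecidableEq ι] [DecidableEq κ]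
    [Fintype U] (w : U → ℝ) (hw : ∑ u, w u = 1) (e : κ → ι) (he : e.Injective)
    (G : (κ → U) → ℝ) :
    ∑ x : ι → U, (∏ i, w (x i)) * G (x ∘ e) = ∑ z : κ → U, (∏ s, w (z s)) * G z := by
  classical
  let p : ι → Prop := fun i => i ∈ Set.range e
  let E : κ ≃ {i // p i} := Equiv.ofInjective e he
  have h1 : ∑ x : ι → U, (∏ i, w (x i)) * G (x ∘ e) =
      ∑ v : ({i // p i} → U) × ({i // ¬p i} → U),
        ((∏ i, w (v.1 i)) * ∏ i, w (v.2 i)) * G (v.1 ∘ E) := by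
    refine Fintype.sum_equiv (Equiv.piEquivPiSubtypeProd p fun _ => U) _ _ fun x => ?_
    rw [← Fintype.prod_subtype_mul_prod_subtype p fun i => w (x i)]
    refine congrArg₂ (· * ·) (congrArg₂ (· * ·) ?_ rfl) rfl
    exact Finset.prod_congr (by ext; simp) fun _ _ => rfl
  rw [h1, Fintype.sum_prod_type]
  have h2 : ∀ a : {i // p i} → U, ∑ b : {i // ¬p i} → U,
      ((∏ i, w (a i)) * ∏ i, w (b i)) * G (a ∘ E) = (∏ i, w (a i)) * G (a ∘ E) := fun a => by
    rw [← Finset.sum_mul, ← Finset.mul_sum, ← Fintype.prod_sum fun (_ : {i // ¬p i}) u => w u]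
    simp [hw]
  rw [Finset.sum_congr rfl fun a _ => h2 a]
  refine Fintype.sum_equiv (Equiv.arrowCongr E.symm (Equiv.refl U)) _ _ fun a => ?_
  congr 1
  refine (Fintype.prod_equiv E _ _ fun s => rfl).symm

/-- Resetting coordinate `s` to `t` maps each fibre `r s = t'` bijectively onto the fibre `r s = t`,
so the latter is covered `Fintype.card T` times. This is the source of the gain 1/N in the
amplification. -/
theorem sum_update_eq {κ T : Type*} [Fintype κ] [DecidableEq κ] [Fintype T] [DecidableEq T]
    (s : κ) (t : T) (h : (κ → T) → ℝ) :
    ∑ r, h (Function.update r s t) =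
      Fintype.card T * ∑ r : κ → T, if r s = t then h r else 0 := by
  have key : ∀ t', ∑ r : κ → T, (if r s = t' then h (Function.update r s t) else 0) =
      ∑ r : κ → T, if r s = t then h r else 0 := fun t' => by
    rw [← Finset.sum_filter, ← Finset.sum_filter]
    refine Finset.sum_nbij' (fun r => Function.update r s t) (fun r => Function.update r s t')
      ?_ ?_ ?_ ?_ ?_
    · simp
    · simp
    · intro r hr
      simp only [Finset.mem_filter, Finset.mem_univ, true_and] at hr
      simp [← hr]
    · intro r hr
      simp only [Finset.mem_filter, Finset.mem_univ, true_and] at hr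
      simp [← hr]
    · simp
  calc ∑ r, h (Function.update r s t)
      = ∑ r : κ → T, ∑ t', if r s = t' then h (Function.update r s t) else 0 := by simp
    _ = _ := by
      rw [Finset.sum_comm, Finset.sum_congr rfl fun t' _ => key t']
      simp

theorem eq_of_neighbors {U : Type*} [DecidableEq U] {n : ℕ} {x x' : Fin n → U}
    (h : Neighbors x x') : x = x' ∨ ∃ i₀, ∀ i, i ≠ i₀ → x i = x' i := by
  unfold Neighbors hammingDist at h
  by_cases hx : x = x'
  · exact Or.inl hx
  · obtain ⟨j, hj⟩ := Function.ne_iff.1 hx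
    have : Nonempty (Fin n) := ⟨j⟩
    rw [Finset.card_le_one_iff_subset_singleton] at h
    obtain ⟨i₀, hi₀⟩ := h
    refine Or.inr ⟨i₀, fun i hi => ?_⟩
    by_contra hne
    exact hi (Finset.mem_singleton.1 (hi₀ (by simpa using hne)))

theorem neighbors_of_eq_off {U : Type*} [DecidableEq U] {n : ℕ} {x x' : Fin n → U} (i₀ : Fin n)
    (h : ∀ i, i ≠ i₀ → x i = x' i) : Neighbors x x' := by
  unfold Neighbors hammingDist
  refine (Finset.card_le_card (t := {i₀}) fun i hi => ?_).trans (Finset.card_singleton i₀).le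
  rw [Finset.mem_singleton]
  by_contra hne
  simp only [Finset.mem_filter] at hi
  exact hi.2 (h i hne)

/-- Privacy amplification: running `A` on a dataset whose `s`-th record is drawn at random from
the `s`-th of `m` disjoint groups of `N` records. -/
theorem exists_isPureDP_subsample {U : Type*} [Fintype U] [DecidableEq U] {m n N : ℕ} {ε η : ℝ}
    (A : Sampler U m) (hA : IsPureDP ε A) (hA0 : ∀ x y, A x y ≠ 0) (hε : 0 ≤ ε) (hN : 0 < N)
    (hn : m * N ≤ n) (hη : (Real.exp ε - 1) / N ≤ η) :
    ∃ B : Sampler U n, IsPureDP η B ∧ (∀ x y, B x y ≠ 0) ∧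
      ∀ P, outputDist B P = outputDist A P := by
  classical
  let e : Fin m × Fin N → Fin n := fun v => Fin.castLE hn (finProdFinEquiv v)
  have he : e.Injective := (Fin.castLE_injective hn).comp finProdFinEquiv.injective
  have : NeZero N := ⟨hN.ne'⟩
  have hcard : (Fintype.card (Fin m → Fin N) : ℝ) ≠ 0 := by
    exact_mod_cast Fintype.card_ne_zero
  have hcard' : (0 : ℝ) < Fintype.card (Fin m → Fin N) := by
    exact_mod_cast Fintype.card_pos
  have hN' : (0 : ℝ) < N := by exact_mod_cast hN
  let sub : (Fin n → U) → (Fin m → Fin N) → Fin m → U := fun x r s => x (e (s, r s))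
  let B : Sampler U n := fun x => pmfOfReal
    (fun y => (∑ r, (A (sub x r) y).toReal) / Fintype.card (Fin m → Fin N))
    (fun y => div_nonneg (Finset.sum_nonneg fun _ _ => ENNReal.toReal_nonneg) hcard'.le) (by
      rw [← Finset.sum_div, Finset.sum_comm, Finset.sum_congr rfl fun r _ => sum_toReal_eq_one _]
      simp)
  have hB : ∀ x y, (B x y).toReal =
      (∑ r, (A (sub x r) y).toReal) / Fintype.card (Fin m → Fin N) :=
    fun x y => pmfOfReal_toReal _ _ _ y
  have hexp : 1 ≤ Real.exp ε := Real.one_le_exp hε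
  have hη0 : 0 ≤ η := (div_nonneg (by linarith) hN'.le).trans hη
  refine ⟨B, fun x x' hx y => ?_, fun x y h0 => ?_, fun P => ?_⟩
  · rw [hB, hB, mul_div_assoc']
    refine div_le_div_of_nonneg_right ?_ hcard'.le
    have hnn : ∀ z : Fin n → U, 0 ≤ ∑ r, (A (sub z r) y).toReal := fun z =>
      Finset.sum_nonneg fun _ _ => ENNReal.toReal_nonneg
    have hη1 : 1 ≤ Real.exp η := Real.one_le_exp hη0
    -- Either any difference is confined to one record `t` of one group `s`, or it lies outside all
    -- groups and is never sampled.
    by_cases hex : ∃ s t, ∀ i, i ≠ e (s, t) → x i = x' i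
    · obtain ⟨s, t, hst⟩ := hex
      set F : (Fin m → Fin N) → ℝ := fun r => (A (sub x r) y).toReal with hF
      set F' : (Fin m → Fin N) → ℝ := fun r => (A (sub x' r) y).toReal with hF'
      have hF'0 : ∀ r, 0 ≤ F' r := fun r => ENNReal.toReal_nonneg
      have hoff : ∀ r, r s ≠ t → F r = F' r := fun r hr => by
        have : sub x r = sub x' r := funext fun s' => hst _ fun h => by
          have h1 := he h
          rw [Prod.mk.injEq] at h1
          exact hr (h1.1 ▸ h1.2)
        simp only [hF, hF', this]
      have hnb : ∀ r r' : Fin m → Fin N, (∀ s', s' ≠ s → r' s' = r s') →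
          F r ≤ Real.exp ε * F' r' := fun r r' hr => by
        refine hA _ _ (neighbors_of_eq_off s fun s' hs' => ?_) y
        simp only [sub, hr s' hs']
        refine hst _ fun h => hs' ?_
        have h1 := he h
        rw [Prod.mk.injEq] at h1
        exact h1.1
      -- A selection that hits the changed record is compared with the arbitrary selection `r` off
      -- slot `s`: `F` there is at most exp ε times the smaller of the two values of `F'`.
      have hdiff : ∀ r, (F - F') (Function.update r s t) ≤ (Real.exp ε - 1) * F' r := fun r => by
        have h1 := hnb (Function.update r s t) r fun s' hs' => by simp [hs']
        have h2 := hnb (Function.update r s t) (Function.update r s t) fun s' hs' => rfl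
        simp only [Pi.sub_apply]
        rcases le_total (F' r) (F' (Function.update r s t)) with h | h
        · linarith
        · nlinarith
      have hsum : ∑ r, (F r - F' r) ≤ (Real.exp ε - 1) / N * ∑ r, F' r := by
        have h1 : ∑ r, (F r - F' r) = ∑ r : Fin m → Fin N, if r s = t then (F - F') r else 0 := by
          refine Finset.sum_congr rfl fun r _ => ?_
          split_ifs with h
          · rfl
          · rw [hoff r h, sub_self]
        have h2 := sum_update_eq s t (F - F')
        rw [← h1, Fintype.card_fin] at h2
        have h3 : (N : ℝ) * ∑ r, (F r - F' r) ≤ (Real.exp ε - 1) * ∑ r, F' r := by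
          rw [← h2, Finset.mul_sum]
          exact Finset.sum_le_sum fun r _ => hdiff r
        rw [div_mul_eq_mul_div, le_div_iff₀ hN']
        linarith
      rw [Finset.sum_sub_distrib] at hsum
      have h4 := Real.add_one_le_exp η
      have h5 : ((Real.exp ε - 1) / N + 1) * ∑ r, F' r ≤ Real.exp η * ∑ r, F' r :=
        mul_le_mul_of_nonneg_right (by linarith) (hnn x')
      linarith
    · have : ∀ r, sub x r = sub x' r := fun r => funext fun s => by
        rcases eq_of_neighbors hx with h | ⟨i₀, h⟩
        · rw [h]
        · refine h _ fun h0 => hex ⟨s, r s, ?_⟩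
          rwa [h0]
      rw [Finset.sum_congr rfl fun r _ => by rw [this r]]
      nlinarith [hnn x']
  · have h1 := hB x y
    rw [h0, ENNReal.toReal_zero] at h1
    refine (div_pos (Finset.sum_pos (fun r _ => ?_) Finset.univ_nonempty) hcard').ne h1
    exact ENNReal.toReal_pos (hA0 _ _) (PMF.apply_ne_top _ _)
  · ext y
    rw [← ENNReal.toReal_eq_toReal_iff' (PMF.apply_ne_top _ _) (PMF.apply_ne_top _ _),
      toReal_outputDist, toReal_outputDist]
    -- For each fixed `r` the selected positions are distinct, so the selected records are again
    -- i.i.d. with law `P`.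
    have h1 : ∀ r : Fin m → Fin N,
        ∑ x : Fin n → U, (∏ i, (P (x i)).toReal) * (A (sub x r) y).toReal =
        ∑ z : Fin m → U, (∏ i, (P (z i)).toReal) * (A z y).toReal := fun r =>
      sum_prod_mul_comp (fun u => (P u).toReal) (sum_toReal_eq_one P) (fun s => e (s, r s))
        (fun a b h => by
          have := he h
          rw [Prod.mk.injEq] at this
          exact this.1) fun z => (A z y).toReal
    simp only [hB, mul_div_assoc']
    rw [← Finset.sum_div, div_eq_iff hcard]
    simp only [Finset.mul_sum]
    rw [Finset.sum_comm, Finset.sum_congr rfl fun r _ => h1 r]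
    simp [mul_comm]

/-! ### Smoothed frequencies of one column. -/

/-- The frequency of the value `b` in a column of bits, mixed with the uniform distribution. -/
noncomputable def smoothedFreq {m : ℕ} (τ : ℝ) (c : Fin m → Bool) (b : Bool) : ℝ :=
  (1 - 2 * τ) * ((∑ i, if c i = b then (1 : ℝ) else 0) / m) + τ

section smoothedFreq

variable {m : ℕ} {τ : ℝ}

theorem le_smoothedFreq (hτ : τ ≤ 1 / 8) (c : Fin m → Bool) (b : Bool) :
    τ ≤ smoothedFreq τ c b := by
  unfold smoothedFreq
  have : 0 ≤ (∑ i, if c i = b then (1 : ℝ) else 0) / m :=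
    div_nonneg (Finset.sum_nonneg fun i _ => by split_ifs <;> norm_num) (Nat.cast_nonneg _)
  nlinarith

theorem sum_smoothedFreq (hm : 0 < m) (c : Fin m → Bool) : ∑ b, smoothedFreq τ c b = 1 := by
  have hm' : (m : ℝ) ≠ 0 := by exact_mod_cast hm.ne'
  have h : (∑ i, if c i = true then (1 : ℝ) else 0) + (∑ i, if c i = false then (1 : ℝ) else 0)
      = m := by
    rw [← Finset.sum_add_distrib]
    have : ∀ i, ((if c i = true then (1 : ℝ) else 0) + if c i = false then (1 : ℝ) else 0) = 1 :=
      fun i => by cases c i <;> simp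
    simp [this]
  rw [Fintype.sum_bool]
  unfold smoothedFreq
  calc _ = (1 - 2 * τ) * (((∑ i, if c i = true then (1 : ℝ) else 0) +
        (∑ i, if c i = false then (1 : ℝ) else 0)) / m) + 2 * τ := by ring
    _ = 1 := by rw [h, div_self hm']; ring

theorem smoothedFreq_le_one (hτ0 : 0 < τ) (hτ : τ ≤ 1 / 8) (hm : 0 < m) (c : Fin m → Bool)
    (b : Bool) : smoothedFreq τ c b ≤ 1 := by
  rw [← sum_smoothedFreq hm c (τ := τ)]
  exact Finset.single_le_sum (fun b _ => hτ0.le.trans (le_smoothedFreq hτ c b))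
    (Finset.mem_univ b)

theorem smoothedFreq_comp_perm (c : Fin m → Bool) (σ : Equiv.Perm (Fin m)) (b : Bool) :
    smoothedFreq τ (c ∘ σ) b = smoothedFreq τ c b := by
  unfold smoothedFreq
  simp only [Function.comp_apply]
  rw [Equiv.sum_comp σ fun i => if c i = b then (1 : ℝ) else 0]

theorem sum_prod_mul_smoothedFreq (hm : 0 < m) (w : Bool → ℝ) (hw : ∑ b, w b = 1) (b : Bool) :
    ∑ c : Fin m → Bool, (∏ i, w (c i)) * smoothedFreq τ c b = (1 - 2 * τ) * w b + τ := by
  have hm' : (m : ℝ) ≠ 0 := by exact_mod_cast hm.ne'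
  have h1 : ∀ i, ∑ c : Fin m → Bool, (∏ i, w (c i)) * (if c i = b then (1 : ℝ) else 0) = w b :=
    fun i => by
      have := sum_prod_mul_comp w hw (fun _ : Unit => i) (fun _ _ _ => rfl)
        fun z => if z () = b then (1 : ℝ) else 0
      simp only [Function.comp_apply] at this
      rw [this, Fintype.sum_equiv (Equiv.funUnique Unit Bool) _
        (fun u => w u * if u = b then (1 : ℝ) else 0) fun z => by simp]
      simp
  have h2 : ∑ c : Fin m → Bool, ∏ i, w (c i) = 1 := by
    rw [← Fintype.prod_sum fun (_ : Fin m) u => w u]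
    simp only [hw, Finset.prod_const_one]
  have h3 : ∑ c : Fin m → Bool, (∏ i, w (c i)) * ∑ i, (if c i = b then (1 : ℝ) else 0) =
      m * w b := by
    simp only [Finset.mul_sum]
    rw [Finset.sum_comm, Finset.sum_congr rfl fun i _ => h1 i]
    simp
  calc _ = ∑ c : Fin m → Bool, ((1 - 2 * τ) / m *
          ((∏ i, w (c i)) * ∑ i, (if c i = b then (1 : ℝ) else 0)) + τ * ∏ i, w (c i)) := by
        refine Finset.sum_congr rfl fun c _ => ?_
        unfold smoothedFreq
        ring
    _ = _ := by
        rw [Finset.sum_add_distrib, ← Finset.mul_sum, ← Finset.mul_sum, h2, h3]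
        field_simp

/-- The average of the inverse frequencies of the values that occur is at most about `2`. -/
theorem sum_div_smoothedFreq_le (hτ0 : 0 < τ) (hτ : τ ≤ 1 / 8) (hm : 0 < m) (c : Fin m → Bool) :
    ∑ i, τ / smoothedFreq τ c (c i) ≤ m * (4 * τ) := by
  have hm' : (0 : ℝ) < m := by exact_mod_cast hm
  have h1 : ∑ i, τ / smoothedFreq τ c (c i) =
      ∑ b, (∑ i, if c i = b then (1 : ℝ) else 0) * (τ / smoothedFreq τ c b) := by
    simp only [Finset.sum_mul]
    rw [Finset.sum_comm]
    refine Finset.sum_congr rfl fun i _ => ?_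
    simp
  have h2 : ∀ b, (∑ i, if c i = b then (1 : ℝ) else 0) * (τ / smoothedFreq τ c b) ≤
      2 * m * τ := fun b => by
    have hq : 0 < smoothedFreq τ c b := hτ0.trans_le (le_smoothedFreq hτ c b)
    rw [mul_div_assoc', div_le_iff₀ hq]
    set N := ∑ i, if c i = b then (1 : ℝ) else 0 with hN
    have hN0 : 0 ≤ N := Finset.sum_nonneg fun i _ => by split_ifs <;> norm_num
    -- Smoothing at most halves a frequency, so each of the two values contributes at most 2mτ to
    -- the sum.
    have h3 : N ≤ 2 * m * smoothedFreq τ c b := by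
      have : 2 * m * smoothedFreq τ c b = 2 * (1 - 2 * τ) * N + 2 * m * τ := by
        unfold smoothedFreq
        rw [← hN]
        field_simp
      rw [this]
      nlinarith [mul_pos hm' hτ0]
    nlinarith
  rw [h1, Fintype.sum_bool]
  linarith [h2 true, h2 false]

/-- By exchangeability the expectation is the same for every position, hence equals the average over
positions, which is bounded for each column separately. -/
theorem sum_prod_mul_div_smoothedFreq_le (hτ0 : 0 < τ) (hτ : τ ≤ 1 / 8) (w : Bool → ℝ)
    (hw0 : ∀ b, 0 ≤ w b) (hw : ∑ b, w b = 1) (i : Fin m) :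
    ∑ c : Fin m → Bool, (∏ k, w (c k)) * (τ / smoothedFreq τ c (c i)) ≤ 4 * τ := by
  have hm : 0 < m := Fin.pos i
  have hm' : (0 : ℝ) < m := by exact_mod_cast hm
  have h1 : ∀ i', ∑ c : Fin m → Bool, (∏ k, w (c k)) * (τ / smoothedFreq τ c (c i')) =
      ∑ c : Fin m → Bool, (∏ k, w (c k)) * (τ / smoothedFreq τ c (c i)) := fun i' => by
    refine Fintype.sum_equiv (Equiv.arrowCongr (Equiv.swap i i') (Equiv.refl Bool)) _ _ fun c => ?_
    have h : (Equiv.arrowCongr (Equiv.swap i i') (Equiv.refl Bool)) c = c ∘ Equiv.swap i i' := by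
      ext
      simp [Equiv.arrowCongr]
    rw [h, smoothedFreq_comp_perm]
    simp only [Function.comp_apply, Equiv.swap_apply_left]
    rw [Equiv.prod_comp (Equiv.swap i i') fun k => w (c k)]
  have h2 : (m : ℝ) * ∑ c : Fin m → Bool, (∏ k, w (c k)) * (τ / smoothedFreq τ c (c i)) ≤
      m * (4 * τ) := by
    calc _ = ∑ i', ∑ c : Fin m → Bool, (∏ k, w (c k)) * (τ / smoothedFreq τ c (c i')) := by
          rw [Finset.sum_congr rfl fun i' _ => h1 i']
          simp
      _ = ∑ c : Fin m → Bool, (∏ k, w (c k)) * ∑ i', τ / smoothedFreq τ c (c i') := by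
          rw [Finset.sum_comm]
          simp only [Finset.mul_sum]
      _ ≤ ∑ c : Fin m → Bool, (∏ k, w (c k)) * (m * (4 * τ)) :=
          Finset.sum_le_sum fun c _ => mul_le_mul_of_nonneg_left
            (sum_div_smoothedFreq_le hτ0 hτ hm c) (Finset.prod_nonneg fun k _ => hw0 _)
      _ = _ := by
          rw [← Finset.sum_mul, ← Fintype.prod_sum fun (_ : Fin m) u => w u]
          simp only [hw, Finset.prod_const_one, one_mul]
  exact le_of_mul_le_mul_left h2 hm'

theorem exp_mul_le_of_mem_Icc {u : ℝ} (l : ℝ) (h0 : 0 ≤ u) (h1 : u ≤ 1) :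
    Real.exp (l * u) ≤ 1 + u * (Real.exp l - 1) := by
  have := convexOn_exp.2 (Set.mem_univ 0) (Set.mem_univ l) (sub_nonneg.2 h1) h0 (by ring)
  simp only [smul_eq_mul, mul_zero, zero_add, Real.exp_zero, mul_one] at this
  rw [mul_comm l u]
  linarith

/-- One factor of the Chernoff bound: the variable lies in [0, 1] and has mean at most 4τ, so the
chord of the exponential suffices. -/
theorem sum_prod_mul_exp_le (hτ0 : 0 < τ) (hτ : τ ≤ 1 / 8) (w : Bool → ℝ)
    (hw0 : ∀ b, 0 ≤ w b) (hw : ∑ b, w b = 1) (i : Fin m) {l : ℝ} (hl : 0 ≤ l) :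
    ∑ c : Fin m → Bool, (∏ k, w (c k)) * Real.exp (l * (τ / smoothedFreq τ c (c i))) ≤
      Real.exp (4 * τ * (Real.exp l - 1)) := by
  have hl1 : 0 ≤ Real.exp l - 1 := sub_nonneg.2 (Real.one_le_exp hl)
  calc _ ≤ ∑ c : Fin m → Bool, ((∏ k, w (c k)) +
          (∏ k, w (c k)) * (τ / smoothedFreq τ c (c i)) * (Real.exp l - 1)) := by
        refine Finset.sum_le_sum fun c _ => ?_
        have hq : 0 < smoothedFreq τ c (c i) := hτ0.trans_le (le_smoothedFreq hτ c _)
        have h := exp_mul_le_of_mem_Icc l (div_pos hτ0 hq).le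
          ((div_le_one hq).2 (le_smoothedFreq hτ c _))
        refine (mul_le_mul_of_nonneg_left h (Finset.prod_nonneg fun k _ => hw0 _)).trans (le_of_eq ?_)
        ring
    _ = 1 + (∑ c : Fin m → Bool, (∏ k, w (c k)) * (τ / smoothedFreq τ c (c i))) *
          (Real.exp l - 1) := by
        rw [Finset.sum_add_distrib, ← Finset.sum_mul, ← Fintype.prod_sum fun (_ : Fin m) u => w u]
        simp only [hw, Finset.prod_const_one]
    _ ≤ 1 + 4 * τ * (Real.exp l - 1) := by
        have := mul_le_mul_of_nonneg_right
          (sum_prod_mul_div_smoothedFreq_le hτ0 hτ w hw0 hw i) hl1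
        linarith
    _ ≤ _ := by linarith [Real.add_one_le_exp (4 * τ * (Real.exp l - 1))]

/-- Log t ≤ t - 1 in another form. The change is measured relative to the larger value `a`, at the
price of a logarithm; this lets sensitivity be expressed by the old frequencies alone. -/
theorem log_div_le {a b : ℝ} (hb : 0 < b) (hab : b ≤ a) :
    Real.log (a / b) ≤ (a - b) / a * (1 + Real.log (a / b)) := by
  have ha : 0 < a := hb.trans_le hab
  have h := Real.log_le_sub_one_of_pos (div_pos ha hb)
  have h1 : (a - b) / a * (1 + Real.log (a / b)) =
      Real.log (a / b) + b / a * (a / b - 1 - Real.log (a / b)) := by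
    field_simp
    ring
  rw [h1]
  have : 0 ≤ b / a * (a / b - 1 - Real.log (a / b)) :=
    mul_nonneg (div_pos hb ha).le (by linarith)
  linarith

/-- Changing a set `D` of entries changes a frequency by a factor that only depends on how often
the value occurs among the old entries. -/
theorem smoothedFreq_le_exp_mul (hτ0 : 0 < τ) (hτ : τ ≤ 1 / 8) (hm : 0 < m) (c c' : Fin m → Bool)
    (D : Finset (Fin m)) (hD : ∀ i, i ∉ D → c i = c' i) (b : Bool) :
    smoothedFreq τ c b ≤ Real.exp ((1 + Real.log (1 / τ)) / (m * τ) *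
      ∑ i ∈ D, τ / smoothedFreq τ c (c i)) * smoothedFreq τ c' b := by
  have hm' : (0 : ℝ) < m := by exact_mod_cast hm
  set q := smoothedFreq τ c b with hq
  set q' := smoothedFreq τ c' b with hq'
  have hq0 : 0 < q := hτ0.trans_le (le_smoothedFreq hτ c b)
  have hq'0 : 0 < q' := hτ0.trans_le (le_smoothedFreq hτ c' b)
  have hL : 0 ≤ Real.log (1 / τ) := Real.log_nonneg (by rw [le_div_iff₀ hτ0]; linarith)
  have hterm : ∀ i, 0 ≤ τ / smoothedFreq τ c (c i) := fun i =>
    (div_pos hτ0 (hτ0.trans_le (le_smoothedFreq hτ c _))).le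
  have hS0 : 0 ≤ ∑ i ∈ D, τ / smoothedFreq τ c (c i) := Finset.sum_nonneg fun i _ => hterm i
  have hm0 : 0 < m * τ := mul_pos hm' hτ0
  rcases le_total q q' with h | h
  · refine h.trans (le_mul_of_one_le_left hq'0.le (Real.one_le_exp ?_))
    exact mul_nonneg (div_nonneg (by linarith) hm0.le) hS0
  · rw [← div_le_iff₀ hq'0, ← Real.log_le_iff_le_exp (div_pos hq0 hq'0)]
    have hlog : Real.log (q / q') ≤ Real.log (1 / τ) :=
      Real.log_le_log (div_pos hq0 hq'0) (div_le_div₀ zero_le_one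
        (smoothedFreq_le_one hτ0 hτ hm c b) hτ0 (le_smoothedFreq hτ c' b))
    have hsub : q - q' ≤ (∑ i ∈ D, if c i = b then (1 : ℝ) else 0) / m := by
      have h1 : (∑ i, if c i = b then (1 : ℝ) else 0) - (∑ i, if c' i = b then (1 : ℝ) else 0) ≤
          ∑ i ∈ D, if c i = b then (1 : ℝ) else 0 := by
        rw [← Finset.sum_sub_distrib, ← Finset.sum_filter_add_sum_filter_not Finset.univ (· ∈ D)]
        have h2 : ∑ i with i ∉ D, ((if c i = b then (1 : ℝ) else 0) -
            if c' i = b then (1 : ℝ) else 0) = 0 :=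
          Finset.sum_eq_zero fun i hi => by
            rw [hD i (Finset.mem_filter.1 hi).2, sub_self]
        rw [h2, add_zero, Finset.filter_mem_eq_inter, Finset.univ_inter]
        refine Finset.sum_le_sum fun i _ => ?_
        have : (0 : ℝ) ≤ if c' i = b then (1 : ℝ) else 0 := by split_ifs <;> norm_num
        linarith
      have h3 : q - q' = (1 - 2 * τ) * (((∑ i, if c i = b then (1 : ℝ) else 0) -
          (∑ i, if c' i = b then (1 : ℝ) else 0)) / m) := by
        rw [hq, hq']
        unfold smoothedFreq
        ring
      have h4 : 0 ≤ q - q' := sub_nonneg.2 h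
      have h5 : ((∑ i, if c i = b then (1 : ℝ) else 0) -
          (∑ i, if c' i = b then (1 : ℝ) else 0)) / m ≤
          (∑ i ∈ D, if c i = b then (1 : ℝ) else 0) / m := by gcongr
      have h6 : q - q' ≤ ((∑ i, if c i = b then (1 : ℝ) else 0) -
          (∑ i, if c' i = b then (1 : ℝ) else 0)) / m := by
        nlinarith
      exact h6.trans h5
    -- A changed entry equal to `b` contributes 1/`q` on both sides; the other entries only increase
    -- the right side.
    have hS : (∑ i ∈ D, if c i = b then (1 : ℝ) else 0) / q ≤
        (∑ i ∈ D, τ / smoothedFreq τ c (c i)) / τ := by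
      rw [Finset.sum_div, Finset.sum_div]
      refine Finset.sum_le_sum fun i _ => ?_
      split_ifs with hi
      · rw [hi, ← hq]
        have := hτ0.ne'
        field_simp
        exact le_rfl
      · rw [zero_div]
        exact div_nonneg (hterm i) hτ0.le
    calc Real.log (q / q') ≤ (q - q') / q * (1 + Real.log (q / q')) := log_div_le hq'0 h
      _ ≤ (q - q') / q * (1 + Real.log (1 / τ)) :=
        mul_le_mul_of_nonneg_left (by linarith) (div_nonneg (sub_nonneg.2 h) hq0.le)
      _ ≤ (∑ i ∈ D, if c i = b then (1 : ℝ) else 0) / m / q * (1 + Real.log (1 / τ)) :=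
        mul_le_mul_of_nonneg_right (div_le_div_of_nonneg_right hsub hq0.le) (by linarith)
      _ = (∑ i ∈ D, if c i = b then (1 : ℝ) else 0) / q * ((1 + Real.log (1 / τ)) / m) := by ring
      _ ≤ (∑ i ∈ D, τ / smoothedFreq τ c (c i)) / τ * ((1 + Real.log (1 / τ)) / m) :=
        mul_le_mul_of_nonneg_right hS (div_nonneg (by linarith) hm'.le)
      _ = _ := by
        field_simp

end smoothedFreq

/-! ### The column sampler: sensitivity, bias and tails of the record weights. -/

/-- Output probabilities of the sampler that draws each bit from the smoothed frequencies of the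
corresponding column. -/
noncomputable def columnSampler {m d : ℕ} (τ : ℝ) (x : Fin m → Fin d → Bool) (y : Fin d → Bool) :
    ℝ := ∏ j, smoothedFreq τ (fun i => x i j) (y j)

/-- The weight of the record `i`, relative to the smoothed frequencies of its bits. -/
noncomputable def recordWeight {m d : ℕ} (τ : ℝ) (x : Fin m → Fin d → Bool) (i : Fin m) : ℝ :=
  ∑ j, τ / smoothedFreq τ (fun i => x i j) (x i j)

section columnSampler

variable {m d : ℕ} {τ : ℝ}

theorem columnSampler_pos (hτ0 : 0 < τ) (hτ : τ ≤ 1 / 8) (x : Fin m → Fin d → Bool)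
    (y : Fin d → Bool) : 0 < columnSampler τ x y :=
  Finset.prod_pos fun _ _ => hτ0.trans_le (le_smoothedFreq hτ _ _)

theorem sum_columnSampler (hm : 0 < m) (x : Fin m → Fin d → Bool) :
    ∑ y, columnSampler τ x y = 1 := by
  unfold columnSampler
  rw [← Fintype.prod_sum fun j b => smoothedFreq τ (fun i => x i j) b]
  exact Finset.prod_eq_one fun j _ => sum_smoothedFreq hm _

/-- Multiplying the column bounds and exchanging sums turns the exponents into the total weight of
the changed records. Only the weights in `x` matter; `x'` is arbitrary. -/
theorem columnSampler_le_exp_mul (hτ0 : 0 < τ) (hτ : τ ≤ 1 / 8) (hm : 0 < m) {s : ℝ}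
    (x x' : Fin m → Fin d → Bool) (hx : ∀ i, recordWeight τ x i ≤ s) (y : Fin d → Bool) :
    columnSampler τ x y ≤ Real.exp ((1 + Real.log (1 / τ)) / (m * τ) * s * hammingDist x x') *
      columnSampler τ x' y := by
  have hm' : (0 : ℝ) < m := by exact_mod_cast hm
  have hL : 0 ≤ Real.log (1 / τ) := Real.log_nonneg (by rw [le_div_iff₀ hτ0]; linarith)
  set D : Finset (Fin m) := Finset.univ.filter fun i => x i ≠ x' i with hD
  calc columnSampler τ x y
      ≤ ∏ j, (Real.exp ((1 + Real.log (1 / τ)) / (m * τ) *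
          ∑ i ∈ D, τ / smoothedFreq τ (fun i => x i j) (x i j)) *
          smoothedFreq τ (fun i => x' i j) (y j)) := by
        refine Finset.prod_le_prod (fun j _ => hτ0.le.trans (le_smoothedFreq hτ _ _)) fun j _ => ?_
        refine smoothedFreq_le_exp_mul hτ0 hτ hm (fun i => x i j) (fun i => x' i j) D
          (fun i hi => ?_) (y j)
        simp only [hD, Finset.mem_filter, Finset.mem_univ, true_and, not_not] at hi
        exact congrFun hi j
    _ = Real.exp ((1 + Real.log (1 / τ)) / (m * τ) * ∑ i ∈ D, recordWeight τ x i) *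
          columnSampler τ x' y := by
        rw [Finset.prod_mul_distrib, ← Real.exp_sum, ← Finset.mul_sum, Finset.sum_comm]
        rfl
    _ ≤ _ := by
        refine mul_le_mul_of_nonneg_right (Real.exp_le_exp.2 ?_) (columnSampler_pos hτ0 hτ _ _).le
        rw [mul_assoc]
        refine mul_le_mul_of_nonneg_left ?_ (div_nonneg (by linarith) (mul_pos hm' hτ0).le)
        refine (Finset.sum_le_sum fun i _ => hx i).trans (le_of_eq ?_)
        rw [Finset.sum_const, nsmul_eq_mul, mul_comm]
        rfl

/-- Under a product distribution the columns of a dataset are independent. -/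
theorem sum_prod_columns (w : Fin d → Bool → ℝ) (g : Fin d → (Fin m → Bool) → ℝ) :
    ∑ x : Fin m → Fin d → Bool, (∏ i, ∏ j, w j (x i j)) * ∏ j, g j (fun i => x i j) =
      ∏ j, ∑ c : Fin m → Bool, (∏ i, w j (c i)) * g j c := by
  rw [Fintype.prod_sum fun j (c : Fin m → Bool) => (∏ i, w j (c i)) * g j c]
  refine Fintype.sum_equiv (Equiv.piComm fun (_ : Fin m) (_ : Fin d) => Bool) _ _ fun x => ?_
  rw [Finset.prod_comm, ← Finset.prod_mul_distrib]
  rfl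

/-- Independence of the columns makes the expectation factor, and each frequency is unbiased up to
smoothing; Bernoulli's inequality collects the `d` losses. -/
theorem le_sum_columnSampler (hτ0 : 0 < τ) (hτ : τ ≤ 1 / 8) (hm : 0 < m) (w : Fin d → Bool → ℝ)
    (hw0 : ∀ j b, 0 ≤ w j b) (hw : ∀ j, ∑ b, w j b = 1) (y : Fin d → Bool) :
    (1 - 2 * d * τ) * ∏ j, w j (y j) ≤
      ∑ x : Fin m → Fin d → Bool, (∏ i, ∏ j, w j (x i j)) * columnSampler τ x y := by
  unfold columnSampler
  rw [sum_prod_columns w fun j c => smoothedFreq τ c (y j)]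
  simp only [sum_prod_mul_smoothedFreq hm _ (hw _)]
  have h1 : 1 - 2 * d * τ ≤ (1 - 2 * τ) ^ d := by
    have := one_add_mul_le_pow (a := -(2 * τ)) (by linarith) d
    rw [← sub_eq_add_neg] at this
    linarith
  calc (1 - 2 * d * τ) * ∏ j, w j (y j) ≤ (1 - 2 * τ) ^ d * ∏ j, w j (y j) :=
        mul_le_mul_of_nonneg_right h1 (Finset.prod_nonneg fun j _ => hw0 _ _)
    _ = ∏ j, (1 - 2 * τ) * w j (y j) := by
        rw [Finset.prod_mul_distrib]
        simp
    _ ≤ _ := Finset.prod_le_prod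
        (fun j _ => mul_nonneg (by linarith) (hw0 _ _)) fun j _ => by linarith

/-- Records of large weight are unlikely. -/
theorem sum_recordWeight_gt_le (hτ0 : 0 < τ) (hτ : τ ≤ 1 / 8) (w : Fin d → Bool → ℝ)
    (hw0 : ∀ j b, 0 ≤ w j b) (hw : ∀ j, ∑ b, w j b = 1) {l : ℝ} (hl : 0 ≤ l) (s : ℝ) (i : Fin m) :
    ∑ x : Fin m → Fin d → Bool, (if s < recordWeight τ x i then ∏ i, ∏ j, w j (x i j) else 0) ≤
      Real.exp (-(l * s)) * Real.exp (4 * d * τ * (Real.exp l - 1)) := by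
  have hW : ∀ x : Fin m → Fin d → Bool, 0 ≤ ∏ i, ∏ j, w j (x i j) := fun x =>
    Finset.prod_nonneg fun i _ => Finset.prod_nonneg fun j _ => hw0 _ _
  -- Markov's inequality for the exponential of `l` times the weight, which then factors over the
  -- columns.
  calc _ ≤ ∑ x : Fin m → Fin d → Bool, Real.exp (-(l * s)) * ((∏ i, ∏ j, w j (x i j)) *
          ∏ j, Real.exp (l * (τ / smoothedFreq τ (fun i => x i j) (x i j)))) := by
        refine Finset.sum_le_sum fun x _ => ?_
        rw [← Real.exp_sum, ← Finset.mul_sum, mul_left_comm, ← Real.exp_add]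
        split_ifs with h
        · refine le_mul_of_one_le_right (hW x) (Real.one_le_exp ?_)
          have : l * s ≤ l * recordWeight τ x i := mul_le_mul_of_nonneg_left h.le hl
          unfold recordWeight at this
          linarith
        · exact mul_nonneg (hW x) (Real.exp_pos _).le
    _ = Real.exp (-(l * s)) * ∏ j, ∑ c : Fin m → Bool, (∏ k, w j (c k)) *
          Real.exp (l * (τ / smoothedFreq τ c (c i))) := by
        rw [← Finset.mul_sum,
          sum_prod_columns w fun _ c => Real.exp (l * (τ / smoothedFreq τ c (c i)))]
    _ ≤ Real.exp (-(l * s)) * ∏ _j : Fin d, Real.exp (4 * τ * (Real.exp l - 1)) := by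
        refine mul_le_mul_of_nonneg_left (Finset.prod_le_prod (fun j _ => ?_) fun j _ =>
          sum_prod_mul_exp_le hτ0 hτ (w j) (hw0 j) (hw j) i hl) (Real.exp_pos _).le
        exact Finset.sum_nonneg fun c _ =>
          mul_nonneg (Finset.prod_nonneg fun k _ => hw0 _ _) (Real.exp_pos _).le
    _ = _ := by
        rw [Finset.prod_const, Finset.card_univ, Fintype.card_fin, ← Real.exp_nat_mul]
        ring_nf

theorem sum_exists_recordWeight_gt_le (hτ0 : 0 < τ) (hτ : τ ≤ 1 / 8) (w : Fin d → Bool → ℝ)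
    (hw0 : ∀ j b, 0 ≤ w j b) (hw : ∀ j, ∑ b, w j b = 1) {l : ℝ} (hl : 0 ≤ l) (s : ℝ) :
    ∑ x : Fin m → Fin d → Bool,
        (if ∀ i, recordWeight τ x i ≤ s then 0 else ∏ i, ∏ j, w j (x i j)) ≤
      m * (Real.exp (-(l * s)) * Real.exp (4 * d * τ * (Real.exp l - 1))) := by
  have hW : ∀ x : Fin m → Fin d → Bool, 0 ≤ ∏ i, ∏ j, w j (x i j) := fun x =>
    Finset.prod_nonneg fun i _ => Finset.prod_nonneg fun j _ => hw0 _ _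
  have hnn : ∀ (x : Fin m → Fin d → Bool) (i : Fin m),
      0 ≤ if s < recordWeight τ x i then ∏ i, ∏ j, w j (x i j) else 0 := fun x i => by
    split_ifs
    · exact hW x
    · exact le_rfl
  calc _ ≤ ∑ x : Fin m → Fin d → Bool, ∑ i,
          (if s < recordWeight τ x i then ∏ i, ∏ j, w j (x i j) else 0) := by
        refine Finset.sum_le_sum fun x _ => ?_
        split_ifs with h
        · exact Finset.sum_nonneg fun i _ => hnn x i
        · push Not at h
          obtain ⟨i, hi⟩ := h
          refine le_trans (le_of_eq ?_) (Finset.single_le_sum (fun i _ => hnn x i)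
            (Finset.mem_univ i))
          rw [if_pos hi]
    _ = ∑ i, ∑ x : Fin m → Fin d → Bool,
          (if s < recordWeight τ x i then ∏ i, ∏ j, w j (x i j) else 0) := Finset.sum_comm
    _ ≤ ∑ _i : Fin m, Real.exp (-(l * s)) * Real.exp (4 * d * τ * (Real.exp l - 1)) :=
        Finset.sum_le_sum fun i _ => sum_recordWeight_gt_le hτ0 hτ w hw0 hw hl s i
    _ = _ := by simp

end columnSampler

/-! ### Assembly of the sampler and choice of parameters. -/

/-- A purely private sampler for product distributions, from bounds on the tail of the record
weights and on the sensitivity. -/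
theorem exists_isPureDP_of_tail {d m : ℕ} {α τ s l ε : ℝ} (hd : 0 < d) (hm : 0 < m)
    (hα : α < 1) (hτ0 : 0 < τ) (hτ : τ ≤ 1 / 8) (hs : 0 ≤ s) (hl : 0 ≤ l)
    (hτα : 2 * d * τ ≤ α / 2) (hε : (1 + Real.log (1 / τ)) / (m * τ) * s ≤ ε)
    (htail : m * (Real.exp (-(l * s)) * Real.exp (4 * d * τ * (Real.exp l - 1))) ≤ α / 2) :
    ∃ A : Sampler (Fin d → Bool) m, IsPureDP (2 * ε) A ∧ (∀ x y, A x y ≠ 0) ∧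
      IsAccurate α A (bernoulliProducts d) := by
  classical
  have hm' : (0 : ℝ) < m := by exact_mod_cast hm
  have hL : 0 ≤ Real.log (1 / τ) := Real.log_nonneg (by rw [le_div_iff₀ hτ0]; linarith)
  have hε0 : 0 ≤ ε :=
    (mul_nonneg (div_nonneg (by linarith) (mul_pos hm' hτ0).le) hs).trans hε
  have hbad := fun w hw0 hw =>
    (sum_exists_recordWeight_gt_le (m := m) (d := d) hτ0 hτ w hw0 hw hl s).trans htail
  set H : Finset (Fin m → Fin d → Bool) :=
    Finset.univ.filter fun x => ∀ i, recordWeight τ x i ≤ s with hH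
  -- If `H` were empty, the tail bound for uniform bits would give 1 ≤ α/2.
  have hHne : H.Nonempty := by
    by_contra hne
    rw [Finset.not_nonempty_iff_eq_empty, Finset.filter_eq_empty_iff] at hne
    have h1 := hbad (fun _ _ => 1 / 2) (fun _ _ => by norm_num) (fun _ => by norm_num)
    rw [Finset.sum_congr rfl fun x hx => if_neg (hne hx)] at h1
    have h2 : ∑ x : Fin m → Fin d → Bool, ∏ i : Fin m, ∏ j : Fin d, (1 / 2 : ℝ) = 1 := by
      simp only [Finset.prod_const, Finset.sum_const, Finset.card_univ, nsmul_eq_mul]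
      simp [← pow_mul]
    rw [h2] at h1
    linarith
  obtain ⟨A, hA, hA0, hAH⟩ := exists_isPureDP_extension hε0 (columnSampler τ)
    (fun x y => columnSampler_pos hτ0 hτ x y) (fun x => sum_columnSampler hm x) H hHne
    fun x hx x' _ y => by
      refine (columnSampler_le_exp_mul hτ0 hτ hm x x' (Finset.mem_filter.1 hx).2 y).trans ?_
      refine mul_le_mul_of_nonneg_right (Real.exp_le_exp.2 ?_) (columnSampler_pos hτ0 hτ _ _).le
      exact mul_le_mul_of_nonneg_right hε (Nat.cast_nonneg _)
  refine ⟨A, hA, hA0, ?_⟩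
  rintro _ ⟨p, rfl⟩
  set w : Fin d → Bool → ℝ := fun j b => (bernoulliPMF (p j) b).toReal with hw
  have hw0 : ∀ j b, 0 ≤ w j b := fun j b => ENNReal.toReal_nonneg
  have hw1 : ∀ j, ∑ b, w j b = 1 := fun j => sum_toReal_eq_one _
  have hP : ∀ y, (productPMF (fun j => bernoulliPMF (p j)) y).toReal = ∏ j, w j (y j) :=
    fun y => toReal_productPMF _ y
  have hW : ∀ x : Fin m → Fin d → Bool, 0 ≤ ∏ i, ∏ j, w j (x i j) := fun x =>
    Finset.prod_nonneg fun i _ => Finset.prod_nonneg fun j _ => hw0 _ _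
  -- The deficit of the output law has two sources: the smoothing bias and the mass of the datasets
  -- outside `H`, where the extension is only known to be nonnegative.
  refine tvDist_le (g := fun y => 2 * d * τ * ∏ j, w j (y j) +
    ∑ x : Fin m → Fin d → Bool, (if ∀ i, recordWeight τ x i ≤ s then 0 else
      ∏ i, ∏ j, w j (x i j)) * columnSampler τ x y) (fun y => ?_) (fun y => ?_) ?_
  · rw [toReal_outputDist]
    simp only [hP]
    have h1 := le_sum_columnSampler hτ0 hτ hm w hw0 hw1 y
    have h2 : ∑ x : Fin m → Fin d → Bool, (∏ i, ∏ j, w j (x i j)) * columnSampler τ x y ≤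
        ∑ x : Fin m → Fin d → Bool, ((if ∀ i, recordWeight τ x i ≤ s then 0 else
          ∏ i, ∏ j, w j (x i j)) * columnSampler τ x y +
          (∏ i, ∏ j, w j (x i j)) * (A x y).toReal) := by
      refine Finset.sum_le_sum fun x _ => ?_
      split_ifs with h
      · rw [hAH x (by simpa [hH] using h)]
        linarith
      · have := mul_nonneg (hW x) (ENNReal.toReal_nonneg (a := A x y))
        linarith
    rw [Finset.sum_add_distrib] at h2
    linarith
  · refine add_nonneg (mul_nonneg (by positivity) (Finset.prod_nonneg fun j _ => hw0 _ _))
      (Finset.sum_nonneg fun x _ => mul_nonneg ?_ (columnSampler_pos hτ0 hτ x y).le)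
    split_ifs
    · exact le_rfl
    · exact hW x
  · rw [Finset.sum_add_distrib, ← Finset.mul_sum, Finset.sum_comm,
      ← Fintype.prod_sum fun j b => w j b]
    simp only [← Finset.mul_sum, sum_columnSampler hm, mul_one, hw1, Finset.prod_const_one]
    have := hbad w hw0 hw1
    linarith

theorem log_add_two_ge_one {d : ℕ} (hd : 0 < d) : 1 ≤ Real.log (d + 2) := by
  have hd' : (1 : ℝ) ≤ d := by exact_mod_cast hd
  rw [Real.le_log_iff_exp_le (by linarith)]
  linarith [Real.exp_one_lt_d9]

/-- The union bound over `m` records is harmless: `m` is at most polynomial in d and 1/α, and the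
tail is a higher inverse power. -/
theorem mul_tail_bound_le {m d α e : ℝ} (hd : 1 ≤ d) (hα0 : 0 < α) (hα : α ≤ 1 / 2)
    (hm : m ≤ 8 * d * (4 * d / α) * (36 * (d + 2)) / α + 1) (he0 : 0 ≤ e) (he : e ≤ 3) :
    m * (α ^ 4 / (d + 2) ^ 16 * e) ≤ α / 2 := by
  have h3 : m ≤ 1153 * (d + 2) ^ 3 / α ^ 2 := by
    have h5 : 8 * d * (4 * d / α) * (36 * (d + 2)) / α = 1152 * (d ^ 2 * (d + 2)) / α ^ 2 := by
      field_simp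
      norm_num
    rw [h5] at hm
    refine hm.trans ?_
    rw [le_div_iff₀ (by positivity), add_mul, div_mul_cancel₀ _ (by positivity)]
    have h6 : d ^ 2 * (d + 2) ≤ (d + 2) ^ 3 := by
      rw [pow_succ (d + 2) 2]
      gcongr
      linarith
    have h7 : α ^ 2 ≤ 1 := pow_le_one₀ hα0.le (by linarith)
    have h8 : 1 ≤ (d + 2) ^ 3 := one_le_pow₀ (by linarith)
    linarith
  calc m * (α ^ 4 / (d + 2) ^ 16 * e)
      ≤ 1153 * (d + 2) ^ 3 / α ^ 2 * (α ^ 4 / (d + 2) ^ 16 * 3) := by gcongr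
    _ = 3459 * α ^ 2 / (d + 2) ^ 13 := by
      field_simp
      norm_num
    _ ≤ 3459 * α ^ 2 / 3 ^ 13 := by
      gcongr
      linarith
    _ ≤ α / 2 := by nlinarith

theorem exists_isPureDP_one : ∃ C : ℝ, 0 < C ∧ ∀ (d : ℕ) (α : ℝ), 0 < d → 0 < α → α ≤ 1 / 2 →
    ∃ m : ℕ, (m : ℝ) ≤ C * (d / α) * (Real.log (d + 2) ^ 2 + Real.log (1 / α)) ∧
      ∃ A : Sampler (Fin d → Bool) m, IsPureDP 1 A ∧ (∀ x y, A x y ≠ 0) ∧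
        IsAccurate α A (bernoulliProducts d) := by
  refine ⟨1300, by norm_num, fun d α hd hα0 hα => ?_⟩
  have hd1 : (1 : ℝ) ≤ d := by exact_mod_cast hd
  have hd0 : (0 : ℝ) < d := by linarith
  set X := Real.log (d + 2) with hX
  set Y := Real.log (1 / α) with hY
  set τ := α / (4 * d) with hτ
  set L := 1 + Real.log (1 / τ) with hL
  -- With Chernoff parameter l = `Y`, this makes exp(-ls) = α⁴/(d+2)¹⁶, while 4dτ = α cancels exp
  -- `Y` = 1/α in the other factor, leaving at most e. Dividing by `Y` keeps the log(1/α) term of `L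
  -- * s` linear.
  set s := 4 + 16 * X / Y with hs
  have hX1 : 1 ≤ X := log_add_two_ge_one hd
  have hX2 : X ≤ d + 2 := by
    have := Real.log_le_sub_one_of_pos (by linarith : (0 : ℝ) < d + 2)
    linarith
  have hY1 : 1 / 2 ≤ Y := by
    have h1 : Real.log 2 ≤ Y := Real.log_le_log (by norm_num) (by
      rw [le_div_iff₀ hα0]
      linarith)
    linarith [Real.log_two_gt_d9]
  have hY0 : 0 < Y := by linarith
  have hexpY : Real.exp Y = 1 / α := Real.exp_log (by positivity)
  have hexpX : Real.exp X = d + 2 := Real.exp_log (by positivity)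
  have hτ0 : 0 < τ := by positivity
  have hτ8 : τ ≤ 1 / 8 := by
    rw [hτ, div_le_iff₀ (by linarith)]
    linarith
  have hτinv : 1 / τ = 4 * d / α := by rw [hτ, one_div_div]
  have hL1 : L ≤ 4 * d / α := by
    have := Real.log_le_sub_one_of_pos (by positivity : 0 < 1 / τ)
    rw [← hτinv]
    linarith
  have hL2 : L ≤ 4 * X + Y := by
    have h1 : Real.log (1 / τ) = Real.log 4 + Real.log d + Y := by
      rw [hτinv, mul_div_assoc, Real.log_mul (by norm_num) (by positivity), div_eq_mul_one_div,
        Real.log_mul hd0.ne' (by positivity), hY]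
      ring
    have h2 : Real.log 4 ≤ 2 := by
      have : (4 : ℝ) = 2 * 2 := by norm_num
      rw [this, Real.log_mul (by norm_num) (by norm_num)]
      linarith [Real.log_two_lt_d9]
    have h3 : Real.log d ≤ X := Real.log_le_log hd0 (by linarith)
    linarith
  have hL0 : 0 < L := by
    have : 0 ≤ Real.log (1 / τ) := Real.log_nonneg (by rw [le_div_iff₀ hτ0]; linarith)
    linarith
  have hs0 : 0 < s := by positivity
  have hs1 : s ≤ 36 * (d + 2) := by
    have : 16 * X / Y ≤ 32 * X := by
      rw [div_le_iff₀ hY0]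
      nlinarith
    linarith
  -- Chosen so that the Lipschitz constant Ls/(mτ) is at most 1/2; the extension doubles it to 1.
  set v := 8 * d * L * s / α with hv
  have hv0 : 0 < v := by positivity
  set m := ⌈v⌉₊ with hm
  have hm0 : 0 < m := Nat.ceil_pos.2 hv0
  have hm0' : (0 : ℝ) < m := by exact_mod_cast hm0
  have hvm : v ≤ m := Nat.le_ceil v
  have hmv : (m : ℝ) ≤ v + 1 := (Nat.ceil_lt_add_one hv0.le).le
  refine ⟨m, ?_, ?_⟩
  · have h1 : L * s ≤ 160 * X ^ 2 + 4 * Y := by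
      have h2 : (4 * X + Y) * s = 32 * X + 4 * Y + 64 * X ^ 2 / Y := by
        rw [hs]
        field_simp
        ring
      have h3 : 64 * X ^ 2 / Y ≤ 128 * X ^ 2 := by
        rw [div_le_iff₀ hY0]
        nlinarith [sq_nonneg X]
      nlinarith [mul_le_mul_of_nonneg_right hL2 hs0.le]
    have hda : 1 ≤ d / α := by
      rw [le_div_iff₀ hα0]
      linarith
    have h4 : v = 8 * (d / α) * (L * s) := by
      rw [hv]
      ring
    have h5 : v ≤ 8 * (d / α) * (160 * X ^ 2 + 4 * Y) := by
      rw [h4]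
      exact mul_le_mul_of_nonneg_left h1 (by positivity)
    have h6 : 1 ≤ d / α * X ^ 2 := one_le_mul_of_one_le_of_one_le hda (one_le_pow₀ hX1)
    nlinarith [mul_pos (by positivity : 0 < d / α) hY0]
  · have h := exists_isPureDP_of_tail (d := d) (m := m) (α := α) (τ := τ) (s := s) (l := Y)
      (ε := 1 / 2) hd hm0 (by linarith) hτ0 hτ8 hs0.le hY0.le ?_ ?_ ?_
    · norm_num at h
      exact h
    · rw [hτ]
      field_simp
      norm_num
    · rw [div_mul_eq_mul_div, div_le_iff₀ (mul_pos hm0' hτ0)]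
      have h1 : L * s = v * τ / 2 := by
        rw [hv, hτ]
        field_simp
        norm_num
      rw [h1]
      nlinarith
    · have h1 : Real.exp (-(Y * s)) = α ^ 4 / (d + 2) ^ 16 := by
        have h2 : -(Y * s) = -((4 : ℕ) * Y + (16 : ℕ) * X) := by
          rw [hs]
          field_simp
          push_cast
          ring
        rw [h2, Real.exp_neg, Real.exp_add, Real.exp_nat_mul, Real.exp_nat_mul, hexpX, hexpY]
        field_simp
      have h2 : Real.exp (4 * d * τ * (Real.exp Y - 1)) ≤ 3 := by
        have : 4 * d * τ * (Real.exp Y - 1) = 1 - α := by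
          rw [hexpY, hτ]
          field_simp
        rw [this]
        have : Real.exp (1 - α) ≤ Real.exp 1 := Real.exp_le_exp.2 (by linarith)
        linarith [Real.exp_one_lt_d9]
      have h4 : v ≤ 8 * d * (4 * d / α) * (36 * (d + 2)) / α := by
        rw [hv]
        gcongr
      rw [h1]
      exact mul_tail_bound_le hd1 hα0 hα (hmv.trans (by linarith)) (Real.exp_pos _).le h2

theorem exists_isPureDP : ∃ C : ℝ, 0 < C ∧ ∀ (d n : ℕ) (α η : ℝ), 0 < d → 0 < α → α < 1 →
    0 < η → η ≤ 1 →
    C * (d / (α * η)) * (Real.log (d + 2) ^ 2 + Real.log (1 / α)) ≤ n →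
    ∃ A : Sampler (Fin d → Bool) n, IsPureDP η A ∧ (∀ x y, A x y ≠ 0) ∧
      IsAccurate α A (bernoulliProducts d) := by
  obtain ⟨C, hC, h⟩ := exists_isPureDP_one
  refine ⟨12 * C, by positivity, fun d n α η hd hα0 hα1 hη0 hη1 hn => ?_⟩
  have hd0 : (0 : ℝ) < d := by exact_mod_cast hd
  -- Halving α meets the requirement α ≤ 1/2, which keeps log(1/α) away from 0.
  obtain ⟨m, hm, A, hA, hA0, hacc⟩ := h d (α / 2) hd (by linarith) (by linarith)
  have hX1 := log_add_two_ge_one hd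
  have hY0 : 0 ≤ Real.log (1 / α) := Real.log_nonneg (by
    rw [le_div_iff₀ hα0]
    linarith)
  have hlog : Real.log (1 / (α / 2)) ≤ 1 + Real.log (1 / α) := by
    rw [one_div_div, div_eq_mul_one_div, Real.log_mul (by norm_num) (by positivity)]
    linarith [Real.log_two_lt_d9]
  have hm' : (m : ℝ) ≤ 4 * C * (d / α) * (Real.log (d + 2) ^ 2 + Real.log (1 / α)) := by
    refine hm.trans ?_
    have h1 : C * (d / (α / 2)) * (Real.log (d + 2) ^ 2 + Real.log (1 / (α / 2))) ≤
        C * (d / (α / 2)) * (2 * (Real.log (d + 2) ^ 2 + Real.log (1 / α))) := by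
      refine mul_le_mul_of_nonneg_left ?_ (by positivity)
      nlinarith
    refine h1.trans (le_of_eq ?_)
    field_simp
    norm_num
  -- Since e - 1 < 2, groups of this size bring privacy 1 down to η.
  set N := ⌈2 / η⌉₊ with hN
  have hN0 : 0 < N := Nat.ceil_pos.2 (by positivity)
  have hN0' : (0 : ℝ) < N := by exact_mod_cast hN0
  have hN1 : 2 / η ≤ N := Nat.le_ceil _
  have hN2 : (N : ℝ) ≤ 3 / η := by
    have h1 := (Nat.ceil_lt_add_one (by positivity : 0 ≤ 2 / η)).le
    have h2 : 1 ≤ 1 / η := by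
      rw [le_div_iff₀ hη0]
      linarith
    calc (N : ℝ) ≤ 2 / η + 1 / η := by linarith
      _ = 3 / η := by ring
  obtain ⟨B, hB, hB0, hBP⟩ := exists_isPureDP_subsample (n := n) (N := N) (η := η) A hA hA0
    zero_le_one hN0 (by
      have h1 : (m : ℝ) * N ≤ n := by
        calc (m : ℝ) * N ≤ 4 * C * (d / α) * (Real.log (d + 2) ^ 2 + Real.log (1 / α)) *
              (3 / η) := by gcongr
          _ = 12 * C * (d / (α * η)) * (Real.log (d + 2) ^ 2 + Real.log (1 / α)) := by
            field_simp
            norm_num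
          _ ≤ n := hn
      exact_mod_cast h1) (by
      rw [div_le_iff₀ hN0']
      rw [div_le_iff₀ hη0] at hN1
      linarith [Real.exp_one_lt_d9])
  refine ⟨B, hB, hB0, fun P hP => ?_⟩
  rw [hBP]
  exact (hacc P hP).trans (by linarith)

/-- For d = 0 the sample-size hypothesis is vacuous, so this case needs its own, trivial, sampler.
-/
theorem exists_sampler_of_zero (n : ℕ) {α : ℝ} (hα : 0 ≤ α) :
    ∃ A : Sampler (Fin 0 → Bool) n, IsPureDP 0 A ∧ (∀ x y, A x y ≠ 0) ∧
      IsAccurate α A (bernoulliProducts 0) := by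
  have h1 : ∀ (P : PMF (Fin 0 → Bool)) y, (P y).toReal = 1 := fun P y => by
    rw [← sum_toReal_eq_one P, Fintype.sum_subsingleton _ y]
  refine ⟨fun _ => PMF.pure default, fun x x' _ y => by simp, fun x y h => ?_, fun P _ => ?_⟩
  · have := h1 (PMF.pure default) y
    rw [h] at this
    simp at this
  · exact tvDist_le (g := fun _ => 0) (fun y => by rw [h1, h1, sub_self]) (fun _ => le_rfl)
      (by simpa using hα)

/-! ### From the pure sampler to the stated sample sizes and privacy notions. -/

/-- A sample size that dominates `D` times a power of `log D` also dominates `D` times a power of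
the logarithm of the sample size. -/
theorem exists_mul_log_pow_le {B : ℝ} (hB : 0 < B) (k : ℕ) : ∃ C : ℝ, 0 < C ∧ ∀ D n : ℝ, 1 ≤ D →
    C * D * Real.log (Real.exp 1 + D) ^ (k + 2) ≤ n →
    1 ≤ n ∧ B * D * Real.log (Real.exp 1 + D) ^ 2 * (1 + Real.log n) ^ k ≤ n := by
  have hev : ∀ᶠ n : ℝ in Filter.atTop, 9 * B * (1 + Real.log n) ^ k ≤ n ^ (1 / 4 : ℝ) := by
    have h := (isLittleO_log_rpow_rpow_atTop (k : ℝ) (by norm_num : (0 : ℝ) < 1 / 4)).bound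
      (by positivity : (0 : ℝ) < 1 / (9 * B * 2 ^ k))
    filter_upwards [h, Filter.eventually_ge_atTop (Real.exp 1)] with n hn hne
    have hn0 : 0 < n := (Real.exp_pos 1).trans_le hne
    have hlog : 1 ≤ Real.log n := (Real.le_log_iff_exp_le hn0).2 hne
    rw [Real.rpow_natCast, Real.norm_of_nonneg (by positivity),
      Real.norm_of_nonneg (by positivity), div_mul_eq_mul_div, one_mul,
      le_div_iff₀ (by positivity)] at hn
    calc 9 * B * (1 + Real.log n) ^ k ≤ 9 * B * (2 * Real.log n) ^ k := by
          gcongr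
          linarith
      _ = Real.log n ^ k * (9 * B * 2 ^ k) := by
          rw [mul_pow]
          ring
      _ ≤ _ := hn
  obtain ⟨n₀, hn₀⟩ := Filter.eventually_atTop.1 hev
  refine ⟨max (max 1 n₀) (5 ^ k * B), by positivity, fun D n hD hn => ?_⟩
  set C := max (max 1 n₀) (5 ^ k * B) with hC
  set l := Real.log (Real.exp 1 + D) with hl
  have he := Real.exp_pos 1
  have hl1 : 1 ≤ l := (Real.le_log_iff_exp_le (by linarith)).2 (by linarith)
  have hC0 : 0 < C := by positivity
  have hCn : C ≤ n := by
    refine le_trans ?_ hn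
    rw [mul_assoc]
    exact le_mul_of_one_le_right hC0.le (one_le_mul_of_one_le_of_one_le hD (one_le_pow₀ hl1))
  have hn1 : 1 ≤ n := ((le_max_left _ _).trans (le_max_left _ _)).trans hCn
  refine ⟨hn1, ?_⟩
  have hlogn : 0 ≤ Real.log n := Real.log_nonneg hn1
  -- Below D⁴, log n is comparable to log D. Above it, the factors in D are at most of order D³ ≤
  -- n^(3/4), and n^(1/4) absorbs the powers of log n.
  rcases le_total n (D ^ 4) with h | h
  · have h1 : 1 + Real.log n ≤ 5 * l := by
      have h2 : Real.log n ≤ 4 * Real.log D := by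
        have := Real.log_le_log (by linarith) h
        rwa [Real.log_pow] at this
      have h3 : Real.log D ≤ l := Real.log_le_log (by linarith) (by linarith)
      linarith
    calc B * D * l ^ 2 * (1 + Real.log n) ^ k ≤ B * D * l ^ 2 * (5 * l) ^ k := by gcongr
      _ = 5 ^ k * B * D * l ^ (k + 2) := by
        rw [mul_pow]
        ring
      _ ≤ C * D * l ^ (k + 2) := by
        gcongr
        exact le_max_right _ _
      _ ≤ n := hn
  · have h1 := hn₀ n (((le_max_right _ _).trans (le_max_left _ _)).trans hCn)
    set t := n ^ (1 / 4 : ℝ) with ht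
    have ht4 : t ^ 4 = n := by
      rw [ht, ← Real.rpow_natCast, ← Real.rpow_mul (by linarith)]
      norm_num
    have ht0 : 0 ≤ t := Real.rpow_nonneg (by linarith) _
    have hDt : D ≤ t := by
      rw [← ht4] at h
      exact le_of_pow_le_pow_left₀ (by norm_num) ht0 h
    have hl3 : l ≤ 3 * D := by
      have := Real.log_le_sub_one_of_pos (by linarith : 0 < Real.exp 1 + D)
      linarith [Real.exp_one_lt_d9]
    calc B * D * l ^ 2 * (1 + Real.log n) ^ k ≤ B * D * (3 * D) ^ 2 * (1 + Real.log n) ^ k := by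
          gcongr
      _ = D ^ 3 * (9 * B * (1 + Real.log n) ^ k) := by ring
      _ ≤ t ^ 3 * t := by gcongr
      _ = n := by rw [← ht4]; ring

/-- The privacy parameters that a purely private sampler has to meet. -/
theorem privacy_of_isPureDP {U : Type*} [Fintype U] [DecidableEq U] {n : ℕ} {ε δ η : ℝ}
    {A : Sampler U n} (hε : ε ∈ Set.Ioo (0 : ℝ) 1) (hA : IsPureDP η A) (hA0 : ∀ x y, A x y ≠ 0)
    (hη0 : 0 ≤ η) (hη : η ≤ ε / (8 * √(max (Real.log (1 / δ)) (Real.log 2)))) :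
    IsDP ε δ A ∧ (0 < δ → δ ≤ 1 / 2 → IsZCDP (ε ^ 2 / (16 * Real.log (1 / δ))) A) := by
  set M := max (Real.log (1 / δ)) (Real.log 2) with hM
  have hM1 : 1 / 4 ≤ M := (by linarith [Real.log_two_gt_d9] : 1 / 4 ≤ Real.log 2).trans
    (le_max_right _ _)
  have hsq : 1 / 2 ≤ √M := Real.le_sqrt_of_sq_le (by linarith)
  have hηε : η ≤ ε := hη.trans (div_le_self hε.1.le (by linarith))
  refine ⟨hA.isDP hηε, fun hδ0 hδ => hA.isZCDP hA0 hη0 (hηε.trans hε.2.le) ?_⟩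
  have hML : M = Real.log (1 / δ) := max_eq_left (Real.log_le_log (by norm_num) (by
    rw [le_div_iff₀ hδ0]
    linarith))
  rw [← hML]
  calc 4 * η ^ 2 ≤ 4 * (ε / (8 * √M)) ^ 2 := by gcongr
    _ = ε ^ 2 / (16 * M) := by
      rw [div_pow, mul_pow, Real.sq_sqrt (by linarith)]
      ring

end DPSampling

theorem theorem1p6 :
    -- Approximate differential privacy: the sample size is `Õ(d / (α ε))` when `log (1 / δ)` is
    -- bounded by a fixed polynomial in `log n`.
    (∀ (a : ℝ) (k : ℕ), ∃ (C : ℝ) (K : ℕ), 0 < C ∧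
      ∀ (d n : ℕ) (ε δ α : ℝ), ε ∈ Set.Ioo (0 : ℝ) 1 → δ ∈ Set.Ioo (0 : ℝ) 1 →
        α ∈ Set.Ioo (0 : ℝ) 1 →
        Real.log (1 / δ) ≤ a * Real.log n ^ k →
        C * (d / (α * ε)) * Real.log (Real.exp 1 + d / (α * ε)) ^ K ≤ n →
        ∃ A : DPSampling.Sampler (Fin d → Bool) n,
          DPSampling.IsDP ε δ A ∧
          DPSampling.IsAccurate α A (DPSampling.bernoulliProducts d) ∧
          (δ ≤ 1 / 2 → DPSampling.IsZCDP (ε ^ 2 / (16 * Real.log (1 / δ))) A)) ∧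
    -- Zero-mean concentrated differential privacy, with an explicit bound on the sample size.
    (∃ (C : ℝ) (d₀ : ℕ), 0 < C ∧
      ∀ (d n : ℕ) (ρ α : ℝ), d₀ ≤ d → ρ ∈ Set.Ioc (0 : ℝ) 1 → α ∈ Set.Ioo (0 : ℝ) 1 →
        C * (d / (α * √ρ)) *
            (Real.log d ^ (9 / 4 : ℝ) + Real.log (1 / (α * √ρ)) ^ (5 / 4 : ℝ)) ≤ n →
        ∃ A : DPSampling.Sampler (Fin d → Bool) n,
          DPSampling.IsZCDP ρ A ∧
          DPSampling.IsAccurate α A (DPSampling.bernoulliProducts d)) := by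
  obtain ⟨C, hC, hmain⟩ := DPSampling.exists_isPureDP
  constructor
  · intro a k
    obtain ⟨C', hC', hpow⟩ := DPSampling.exists_mul_log_pow_le
      (by positivity : 0 < 16 * C * (1 + |a|)) k
    refine ⟨C', k + 2, hC', fun d n ε δ α hε hδ hα hlog hn => ?_⟩
    obtain ⟨hε0, hε1⟩ := hε
    obtain ⟨hα0, hα1⟩ := hα
    -- The floor log 2 keeps η ≤ ε when δ is close to 1; for δ ≤ 1/2 it is inactive and 4η² is
    -- exactly the required ρ. Only zCDP needs η this small, and the factor √M it costs is
    -- polylogarithmic in n.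
    set M := max (Real.log (1 / δ)) (Real.log 2) with hM
    have hM1 : 1 / 4 ≤ M := (by linarith [Real.log_two_gt_d9] : 1 / 4 ≤ Real.log 2).trans
      (le_max_right _ _)
    have hsq : 1 / 2 ≤ √M := Real.le_sqrt_of_sq_le (by linarith)
    set η := ε / (8 * √M) with hη
    have hη0 : 0 < η := div_pos hε0 (by linarith)
    have hη1 : η ≤ 1 := (div_le_self hε0.le (by linarith)).trans hε1.le
    have hex : ∃ A : DPSampling.Sampler (Fin d → Bool) n, DPSampling.IsPureDP η A ∧
        (∀ x y, A x y ≠ 0) ∧ DPSampling.IsAccurate α A (DPSampling.bernoulliProducts d) := by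
      rcases Nat.eq_zero_or_pos d with rfl | hd
      · obtain ⟨A, hA, hA'⟩ := DPSampling.exists_sampler_of_zero n hα0.le
        exact ⟨A, hA.mono hη0.le, hA'⟩
      refine hmain d n α η hd hα0 hα1 hη0 hη1 ?_
      have hd1 : (1 : ℝ) ≤ d := by exact_mod_cast hd
      set D := d / (α * ε) with hD
      have hαε : α * ε ≤ 1 := mul_le_one₀ hα1.le hε0.le hε1.le
      have hαε0 : 0 < α * ε := mul_pos hα0 hε0
      have hdD : d ≤ D := by
        rw [hD, le_div_iff₀ hαε0]
        nlinarith
      have hαD : 1 / α ≤ D := by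
        rw [hD, div_le_div_iff₀ hα0 hαε0]
        nlinarith
      obtain ⟨hn1, hle⟩ := hpow D n (hd1.trans hdD) hn
      refine le_trans ?_ hle
      set l := Real.log (Real.exp 1 + D) with hl
      have he : 2 < Real.exp 1 := by linarith [Real.exp_one_gt_d9]
      have hX : Real.log (d + 2) ≤ l := Real.log_le_log (by linarith) (by linarith)
      have hX0 : 0 ≤ Real.log (d + 2) := Real.log_nonneg (by linarith)
      have hY : Real.log (1 / α) ≤ l := Real.log_le_log (by positivity) (by linarith)
      have hl1 : 1 ≤ l := (Real.le_log_iff_exp_le (by linarith)).2 (by linarith)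
      have hXY : Real.log (d + 2) ^ 2 + Real.log (1 / α) ≤ 2 * l ^ 2 := by nlinarith
      have hg : 0 ≤ Real.log n := Real.log_nonneg hn1
      have hL0 : 0 ≤ Real.log (1 / δ) := Real.log_nonneg (by
        rw [le_div_iff₀ hδ.1]
        linarith [hδ.2])
      have hsqM : √M ≤ (1 + |a|) * (1 + Real.log n) ^ k := by
        have h1 : M ≤ 1 + Real.log (1 / δ) :=
          max_le (by linarith) (by linarith [Real.log_two_lt_d9])
        have h2 : √M ≤ 1 + Real.log (1 / δ) := Real.sqrt_le_iff.2 ⟨by linarith, by nlinarith⟩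
        have h3 : Real.log n ^ k ≤ (1 + Real.log n) ^ k := by
          gcongr
          linarith
        have h4 : 1 ≤ (1 + Real.log n) ^ k := one_le_pow₀ (by linarith)
        have h5 : a * Real.log n ^ k ≤ |a| * (1 + Real.log n) ^ k :=
          mul_le_mul (le_abs_self a) h3 (by positivity) (abs_nonneg a)
        linarith
      have hDη : d / (α * η) = 8 * D * √M := by
        rw [hη, hD]
        field_simp
      rw [hDη]
      calc C * (8 * D * √M) * (Real.log (d + 2) ^ 2 + Real.log (1 / α))
          ≤ C * (8 * D * √M) * (2 * l ^ 2) := by gcongr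
        _ ≤ C * (8 * D * ((1 + |a|) * (1 + Real.log n) ^ k)) * (2 * l ^ 2) := by gcongr
        _ = _ := by ring
    obtain ⟨A, hA, hA0, hacc⟩ := hex
    obtain ⟨h1, h2⟩ := DPSampling.privacy_of_isPureDP (δ := δ) ⟨hε0, hε1⟩ hA hA0 hη0.le le_rfl
    exact ⟨A, h1, hacc, h2 hδ.1⟩
  -- The choice η = √ρ/2 gives 4η² = ρ. From d ≥ 3 come log d ≥ 1 and d + 2 ≤ d²; the factor 10 is 2
  -- from η times 5 from comparing the logarithms.
  · refine ⟨10 * C, 3, by positivity, fun d n ρ α hd hρ hα hn => ?_⟩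
    obtain ⟨hρ0, hρ1⟩ := hρ
    obtain ⟨hα0, hα1⟩ := hα
    have hd3 : (3 : ℝ) ≤ d := by exact_mod_cast hd
    have hs0 : 0 < √ρ := Real.sqrt_pos.2 hρ0
    have hs1 : √ρ ≤ 1 := Real.sqrt_le_one.2 hρ1
    obtain ⟨A, hA, hA0, hacc⟩ := hmain d n α (√ρ / 2) (by omega) hα0 hα1 (by linarith)
      (by linarith) (by
        refine le_trans ?_ hn
        set x := Real.log d with hx
        set y := Real.log (1 / (α * √ρ)) with hy
        have hx1 : 1 ≤ x := (Real.le_log_iff_exp_le (by linarith)).2 (by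
          linarith [Real.exp_one_lt_d9])
        have hX : Real.log (d + 2) ≤ 2 * x := by
          have h1 : Real.log (d + 2) ≤ Real.log ((d : ℝ) ^ 2) :=
            Real.log_le_log (by linarith) (by nlinarith)
          rwa [Real.log_pow] at h1
        have hX0 : 0 ≤ Real.log (d + 2) := Real.log_nonneg (by linarith)
        have hx9 : x ^ 2 ≤ x ^ (9 / 4 : ℝ) := by
          rw [← Real.rpow_natCast]
          exact Real.rpow_le_rpow_of_exponent_le hx1 (by norm_num)
        have hαρ : α * √ρ ≤ α := mul_le_of_le_one_right hα0.le hs1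
        have hαρ0 : 0 < α * √ρ := mul_pos hα0 hs0
        have hy0 : 0 ≤ y := Real.log_nonneg (by
          rw [le_div_iff₀ hαρ0]
          linarith)
        have hYy : Real.log (1 / α) ≤ y :=
          Real.log_le_log (by positivity) (one_div_le_one_div_of_le hαρ0 hαρ)
        have hy5 : y ≤ 1 + y ^ (5 / 4 : ℝ) := by
          rcases le_total y 1 with h | h
          · linarith [Real.rpow_nonneg hy0 (5 / 4 : ℝ)]
          · have := Real.rpow_le_rpow_of_exponent_le h (by norm_num : (1 : ℝ) ≤ 5 / 4)
            rw [Real.rpow_one] at this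
            linarith
        have hy50 : 0 ≤ y ^ (5 / 4 : ℝ) := Real.rpow_nonneg hy0 _
        have hXY : Real.log (d + 2) ^ 2 + Real.log (1 / α) ≤
            5 * (x ^ (9 / 4 : ℝ) + y ^ (5 / 4 : ℝ)) := by
          have h1 : Real.log (d + 2) ^ 2 ≤ 4 * x ^ 2 := by nlinarith
          have h2 : 1 ≤ x ^ 2 := one_le_pow₀ hx1
          linarith
        calc C * (d / (α * (√ρ / 2))) * (Real.log (d + 2) ^ 2 + Real.log (1 / α))
            ≤ C * (d / (α * (√ρ / 2))) * (5 * (x ^ (9 / 4 : ℝ) + y ^ (5 / 4 : ℝ))) := by gcongr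
          _ = _ := by
            field_simp
            norm_num)
    refine ⟨A, hA.isZCDP hA0 (by linarith) (by linarith) ?_, hacc⟩
    rw [div_pow, Real.sq_sqrt hρ0.le]
    linarith
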